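/- Let $\Omega\subset\mathbb R^d$ be convex and compact, and let $\mathcal M(\Omega)$ be the set of finite nonnegative Borel measures on $\Omega$. *Cone.* Let $\mathfrak C=(\Omega\times[0,\infty))/(\Omega\times\{0\})$ be the cone over $\Omega$, with points $[x,r]$ and the distance $$d_{\mathfrak C}([x_0,r_0],[x_1,r_1])^2=r_0^2+r_1^2-2r_0r_1\cos_\pi(|x_0-x_1|),\qquad \cos_\pi(a)=\cos(\min\{|a|,\pi\}).$$ For $s\in[0,1]$ and $z_j=[x_j,r_j]$ put $L=|x_0-x_1|$ and $Z(s;z_0,z_1)=[(1-\rho)x_0+\rho x_1,\,R]$, where $R\ge 0$, $$R^2=(1-s)^2r_0^2+s^2r_1^2+2s(1-s)r_0r_1\cos_\pi(L),$$ $$\rho=\frac1L\arccos\Big(\frac{(1-s)r_0+sr_1\cos L}{R}\Big)\ \text{ if } L<\pi,\qquad \rho=\tfrac12\big(1+\operatorname{sign}(sr_1-(1-s)r_0)\big)\ \text{ if } L\ge\pi$$ (with $\rho=0$ for $L=0$; for $R=0$ the value is the tip of the cone). *Hellinger–Kantorovich distance.* Let $\mathcal M_2(\mathfrak C)$ be the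 finite nonnegative Borel measures $\lambda$ on $\mathfrak C$ with $\int r^2\,d\lambda<\infty$, and let $\mathfrak P\lambda\in\mathcal M(\Omega)$ be given by $\int_\Omega\varphi\,d\mathfrak P\lambda=\int_{\mathfrak C}r^2\varphi(x)\,d\lambda([x,r])$ for all $\varphi\in C^0(\Omega)$. Let $$W_{\mathfrak C}(\lambda_0,\lambda_1)^2=\inf\Big\{\iint d_{\mathfrak C}(z_0,z_1)^2\,d\gamma : \gamma \text{ a nonnegative Borel measure on }\mathfrak C\times\mathfrak C\text{ with marginals }\lambda_0,\lambda_1\Big\}$$ (which is $\infty$ if $\lambda_0(\mathfrak C)\ne\lambda_1(\mathfrak C)$), and $$\mathsf{HK}(\mu_0,\mu_1)=\inf\{W_{\mathfrak C}(\lambda_0,\lambda_1):\lambda_0,\lambda_1\in\mathcal M_2(\mathfrak C),\ \mathfrak P\lambda_0=\mu_0,\ \mathfrak P\lambda_1=\mu_1\}.$$ For $\mu_0,\mu_1\in\mathcal M(\Omega)$, minimizers $\lambda_0,\lambda_1$ of this problem, and a plan $\gamma$ that is optimal for $W_{\mathfrak C}(\lambda_0,\lambda_1)$, the curve $\mu(s)=\mathfrak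 P\big(Z(s;\cdot,\cdot)_\#\gamma\big)$, $s\in[0,1]$, is called an HK-geodesic built from a cone plan, from $\mu_0$ to $\mu_1$. **Proposition.** Let $\Phi\in C^0(\Omega)$ and $\Lambda\in\mathbb R$, and set $F_\Phi(\mu)=\int_\Omega\Phi\,d\mu$ and $\tilde\Phi([x,r])=r^2\Phi(x)$. The following are equivalent: 1. $F_\Phi$ is $\Lambda$-convex along HK-geodesics built from cone plans: for all $\mu_0,\mu_1\in\mathcal M(\Omega)$, every such geodesic $\mu$ from $\mu_0$ to $\mu_1$ and all $s\in[0,1]$, $$F_\Phi(\mu(s))\le(1-s)F_\Phi(\mu_0)+sF_\Phi(\mu_1)-\Lambda\,\frac{s(1-s)}2\,\mathsf{HK}(\mu_0,\mu_1)^2;$$ 2. $\tilde\Phi$ is geodesically $\Lambda$-convex on $(\mathfrak C,d_{\mathfrak C})$: for every curve $z:[0,1]\to\mathfrak C$ with $d_{\mathfrak C}(z(s),z(t))=|s-t|\,d_{\mathfrak C}(z(0),z(1))$ for all $s,t\in[0,1]$, and all $s\in[0,1]$, $$\tilde\Phi(z(s))\le(1-s)\tilde\Phi(z(0))+s\tilde\Phi(z(1))-\Lambda\,\frac{s(1-s)}2\,d_{\mathfrak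 C}(z(0),z(1))^2.$$ -/

import Mathlib

open MeasureTheory
open scoped NNReal ENNReal unitInterval

noncomputable section

namespace HKCone

variable {d : ℕ}

/-! ### The cone over `Ω` -/

/-- Identify all points of `Ω × {0}`, and nothing else, in `Ω × [0,∞)`. -/
def coneSetoid (Ω : Set (EuclideanSpace ℝ (Fin d))) : Setoid (Ω × ℝ≥0) where
  r p q := p = q ∨ (p.2 = 0 ∧ q.2 = 0)
  iseqv :=
    { refl := fun _ => Or.inl rfl
      symm := by
        rintro p q (h | ⟨h, h'⟩)
        · exact Or.inl h.symm
        · exact Or.inr ⟨h', h⟩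
      trans := by
        rintro p q s (rfl | ⟨h, h'⟩) (rfl | ⟨k, k'⟩)
        · exact Or.inl rfl
        · exact Or.inr ⟨k, k'⟩
        · exact Or.inr ⟨h, h'⟩
        · exact Or.inr ⟨h, k'⟩ }

/-- The cone `(Ω × [0,∞)) / (Ω × {0})`. -/
def Cone (Ω : Set (EuclideanSpace ℝ (Fin d))) : Type := Quotient (coneSetoid Ω)

/-- The quotient topology; for compact `Ω` it is the topology of the cone distance `coneDist`. -/
instance (Ω : Set (EuclideanSpace ℝ (Fin d))) : TopologicalSpace (Cone Ω) :=
  inferInstanceAs (TopologicalSpace (Quotient (coneSetoid Ω)))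

/-- The quotient σ-algebra; it is the Borel σ-algebra, see `borelSpace_cone`. -/
instance (Ω : Set (EuclideanSpace ℝ (Fin d))) : MeasurableSpace (Cone Ω) :=
  inferInstanceAs (MeasurableSpace (Quotient (coneSetoid Ω)))

variable {Ω : Set (EuclideanSpace ℝ (Fin d))}

/-- The class `[x, r]`. -/
def mk (x : Ω) (r : ℝ≥0) : Cone Ω := Quotient.mk (coneSetoid Ω) (x, r)

/-- The coordinate `r` of `[x, r]`. -/
def radius (z : Cone Ω) : ℝ≥0 :=
  Quotient.lift (fun p : Ω × ℝ≥0 => p.2) (by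
    rintro p q (rfl | ⟨h, h'⟩)
    · rfl
    · exact h.trans h'.symm) z

open Classical in
/-- The coordinate `x` of `[x, r]` if `r > 0`; an arbitrary fixed point of `Ω` at the tip. -/
def base (z : Cone Ω) : Ω :=
  Quotient.lift
    (fun p : Ω × ℝ≥0 => if p.2 = 0 then Classical.choice (⟨p.1⟩ : Nonempty Ω) else p.1) (by
    rintro p q (rfl | ⟨h, h'⟩)
    · rfl
    · simp only [h, h', if_true]) z

@[simp] theorem radius_mk (x : Ω) (r : ℝ≥0) : radius (mk x r) = r := rfl

theorem base_mk (x : Ω) {r : ℝ≥0} (hr : r ≠ 0) : base (mk x r) = x := if_neg hr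

theorem mk_zero (x y : Ω) : mk x 0 = mk y 0 := Quotient.sound (Or.inr ⟨rfl, rfl⟩)

theorem mk_base_radius (z : Cone Ω) : mk (base z) (radius z) = z := by
  induction z using Quotient.inductionOn with
  | h p =>
    obtain ⟨x, r⟩ := p
    change mk (base (mk x r)) r = mk x r
    by_cases hr : r = 0
    · subst hr; exact mk_zero _ _
    · rw [base_mk x hr]

theorem measurable_mk : Measurable fun p : Ω × ℝ≥0 => mk p.1 p.2 :=
  fun _ h => h

theorem measurable_radius : Measurable (radius : Cone Ω → ℝ≥0) :=
  measurable_from_quotient.2 measurable_snd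

theorem measurable_base : Measurable (base : Cone Ω → Ω) := by
  classical
  rcases isEmpty_or_nonempty Ω with h | h
  · exact measurable_of_empty_codomain _
  · refine measurable_from_quotient.2 ?_
    exact Measurable.ite (measurable_snd (measurableSet_singleton 0))
      (measurable_const (a := Classical.choice h)) measurable_fst

/-- The σ-algebra of the cone is the Borel σ-algebra of its topology. -/
theorem borelSpace_cone : BorelSpace (Cone Ω) := by
  have hc : Continuous fun p : Ω × ℝ≥0 => mk p.1 p.2 := continuous_quotient_mk'
  refine ⟨le_antisymm ?_ ?_⟩
  · intro A hA
    have hA' : MeasurableSet ((fun p : Ω × ℝ≥0 => mk p.1 p.2) ⁻¹' A) := measurable_mk hA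
    clear hA
    let _ : MeasurableSpace (Cone Ω) := borel (Cone Ω)
    have _ : BorelSpace (Cone Ω) := ⟨rfl⟩
    have key : ∀ V : Set (Ω × ℝ≥0), IsOpen V →
        IsOpen {z : Cone Ω | radius z ≠ 0 ∧ (base z, radius z) ∈ V} := by
      intro V hV
      refine isOpen_coinduced.2 ?_
      have : (fun p : Ω × ℝ≥0 => mk p.1 p.2) ⁻¹'
          {z : Cone Ω | radius z ≠ 0 ∧ (base z, radius z) ∈ V} = {p | p.2 ≠ 0} ∩ V := by
        ext ⟨x, r⟩
        change (r ≠ 0 ∧ (base (mk x r), r) ∈ V) ↔ (r ≠ 0 ∧ (x, r) ∈ V)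
        refine and_congr_right fun hr => ?_
        rw [base_mk x hr]
      exact this.symm ▸ ((isOpen_ne.preimage continuous_snd).inter hV)
    have hpos : MeasurableSet {z : Cone Ω | radius z ≠ 0} := by
      simpa using (key Set.univ isOpen_univ).measurableSet
    have hg : Measurable fun z : {z : Cone Ω | radius z ≠ 0} =>
        (base (z : Cone Ω), radius (z : Cone Ω)) := by
      refine measurable_of_isOpen fun V hV => ?_
      refine ⟨_, (key V hV).measurableSet, ?_⟩
      ext z
      simp [z.2.out]
    have h1 : MeasurableSet (A ∩ {z : Cone Ω | radius z ≠ 0}) := by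
      have := MeasurableSet.subtype_image hpos (hg hA')
      convert this using 1
      ext z
      simp only [Set.mem_inter_iff, Set.mem_ofPred_eq, Set.mem_image, Set.mem_preimage,
        mk_base_radius, Subtype.exists, exists_and_left, exists_prop]
      aesop
    by_cases hT : ∃ z ∈ A, radius z = 0
    · obtain ⟨z₀, hz₀, hr₀⟩ := hT
      have : A = (A ∩ {z : Cone Ω | radius z ≠ 0}) ∪ {z : Cone Ω | radius z ≠ 0}ᶜ := by
        ext z
        by_cases hr : radius z = 0
        · have : z = z₀ := by
            rw [← mk_base_radius z, ← mk_base_radius z₀, hr, hr₀]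
            exact mk_zero _ _
          simp [this, hz₀, hr₀]
        · simp [hr]
      rw [this]
      exact h1.union hpos.compl
    · have : A = A ∩ {z : Cone Ω | radius z ≠ 0} := by
        ext z
        simp only [Set.mem_inter_iff, Set.mem_ofPred_eq]
        exact ⟨fun h => ⟨h, fun h' => hT ⟨z, h, h'⟩⟩, fun h => h.1⟩
      rw [this]
      exact h1
  · refine MeasurableSpace.generateFrom_le fun U hU => ?_
    exact (IsOpen.preimage hc hU).measurableSet

/-! ### Cone distance and geodesic interpolator -/

/-- `cos_π(a) = cos (min {|a|, π})`. -/
def cosPi (a : ℝ) : ℝ := Real.cos (min |a| Real.pi)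

/-- The cone distance
`d([x₀,r₀],[x₁,r₁])² = r₀² + r₁² - 2 r₀ r₁ cos_π(|x₀ - x₁|)`. The value does not depend on
the choice of the base point at the tip, see `coneDist_mk`. -/
def coneDist (z₀ z₁ : Cone Ω) : ℝ :=
  √((radius z₀ : ℝ) ^ 2 + (radius z₁ : ℝ) ^ 2
    - 2 * radius z₀ * radius z₁ * cosPi (dist (base z₀) (base z₁)))

theorem coneDist_mk (x₀ x₁ : Ω) (r₀ r₁ : ℝ≥0) :
    coneDist (mk x₀ r₀) (mk x₁ r₁) =
      √((r₀ : ℝ) ^ 2 + (r₁ : ℝ) ^ 2 - 2 * r₀ * r₁ * cosPi (dist x₀ x₁)) := by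
  unfold coneDist
  by_cases h₀ : r₀ = 0
  · simp [h₀]
  by_cases h₁ : r₁ = 0
  · simp [h₁]
  rw [base_mk x₀ h₀, base_mk x₁ h₁, radius_mk, radius_mk]

/-- `R(s)`, as a function of `L = |x₀ - x₁|`, `r₀`, `r₁`. -/
def interpRadius (s L r₀ r₁ : ℝ) : ℝ :=
  √((1 - s) ^ 2 * r₀ ^ 2 + s ^ 2 * r₁ ^ 2 + 2 * s * (1 - s) * r₀ * r₁ * cosPi L)

/-- `ρ(s)`, as a function of `L = |x₀ - x₁|`, `r₀`, `r₁`. -/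
def interpRho (s L r₀ r₁ : ℝ) : ℝ :=
  if L < Real.pi then
    1 / L * Real.arccos (((1 - s) * r₀ + s * r₁ * Real.cos L) / interpRadius s L r₀ r₁)
  else
    1 / 2 * (1 + Real.sign (s * r₁ - (1 - s) * r₀))

/-- The point `X(s) = (1 - ρ(s)) x₀ + ρ(s) x₁`. -/
def interpPoint (s : ℝ) (x₀ x₁ : EuclideanSpace ℝ (Fin d)) (r₀ r₁ : ℝ) :
    EuclideanSpace ℝ (Fin d) :=
  (1 - interpRho s (dist x₀ x₁) r₀ r₁) • x₀ + interpRho s (dist x₀ x₁) r₀ r₁ • x₁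

open Classical in
/-- `p` as a point of `Ω`, with the default value `x₀` if `p ∉ Ω`. -/
def toBase (x₀ : Ω) (p : EuclideanSpace ℝ (Fin d)) : Ω := if h : p ∈ Ω then ⟨p, h⟩ else x₀

theorem toBase_of_mem (x₀ : Ω) {p : EuclideanSpace ℝ (Fin d)} (h : p ∈ Ω) :
    toBase x₀ p = ⟨p, h⟩ := dif_pos h

/-- The geodesic interpolator `Z(s; z₀, z₁) = [X(s), R(s)]`. For convex `Ω`, `s ∈ [0,1]` and
`R(s) ≠ 0` the point `X(s)` lies in `Ω`, and for `R(s) = 0` the value is the tip whatever base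
point is written; see `interp_mk` and `interp_mk_of_eq_zero`, which also show that the choice of
the base point of `z₀` or `z₁` at the tip is irrelevant. -/
def interp (s : ℝ) (z₀ z₁ : Cone Ω) : Cone Ω :=
  mk (toBase (base z₀) (interpPoint s (base z₀ : EuclideanSpace ℝ (Fin d)) (base z₁)
        (radius z₀) (radius z₁)))
    (interpRadius s (dist (base z₀) (base z₁)) (radius z₀) (radius z₁)).toNNReal

theorem interpRho_mem {s L r₀ r₁ : ℝ} (hs : s ∈ Set.Icc (0 : ℝ) 1) (hL : 0 ≤ L) (h₀ : 0 ≤ r₀)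
    (h₁ : 0 ≤ r₁) (hR : interpRadius s L r₀ r₁ ≠ 0) :
    interpRho s L r₀ r₁ ∈ Set.Icc (0 : ℝ) 1 := by
  unfold interpRho
  split_ifs with hpi
  · refine ⟨mul_nonneg (one_div_nonneg.2 hL) (Real.arccos_nonneg _), ?_⟩
    rcases hL.eq_or_lt with rfl | hL'
    · simp
    rw [one_div, inv_mul_le_iff₀ hL', mul_one]
    have hk : cosPi L = Real.cos L := by
      rw [cosPi, abs_of_nonneg hL, min_eq_left hpi.le]
    have hk1 := Real.cos_le_one L
    have hk0 := Real.neg_one_le_cos L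
    have hR0 : 0 < interpRadius s L r₀ r₁ := lt_of_le_of_ne (Real.sqrt_nonneg _) hR.symm
    have hu : 0 ≤ (1 - s) * r₀ := mul_nonneg (by linarith [hs.2]) h₀
    have hv : 0 ≤ s * r₁ := mul_nonneg hs.1 h₁
    have hRsq : interpRadius s L r₀ r₁ ^ 2 = ((1 - s) * r₀) ^ 2 + (s * r₁) ^ 2
        + 2 * ((1 - s) * r₀) * (s * r₁) * Real.cos L := by
      unfold interpRadius at hR0 ⊢
      rw [Real.sq_sqrt (Real.sqrt_pos.1 hR0).le, hk]
      ring
    generalize (1 - s) * r₀ = u at *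
    generalize s * r₁ = v at *
    generalize interpRadius s L r₀ r₁ = R at *
    have hle : Real.cos L ≤ (u + v * Real.cos L) / R := by
      rw [le_div_iff₀ hR0]
      generalize Real.cos L = k at *
      by_cases hk : 0 ≤ k
      · have : R ≤ u + v := by
          apply le_of_sq_le_sq _ (by positivity)
          rw [hRsq]
          nlinarith [mul_nonneg hu hv]
        nlinarith
      · push Not at hk
        by_contra hcon
        push Not at hcon
        have h3 : u + v * k < 0 := hcon.trans (mul_neg_of_neg_of_pos hk hR0)
        have h4 : (k * R) ^ 2 < (u + v * k) ^ 2 := by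
          have h9 : k * R < 0 := mul_neg_of_neg_of_pos hk hR0
          nlinarith [mul_pos (sub_pos.2 hcon) (neg_pos.2 (add_neg h9 h3))]
        have h5 : v * k ≤ 0 := mul_nonpos_of_nonneg_of_nonpos hv hk.le
        have h6 : u * (u + 2 * (v * k)) ≤ 0 :=
          mul_nonpos_of_nonneg_of_nonpos hu (by linarith)
        have h7 : 0 ≤ 1 - k ^ 2 := by nlinarith
        have h8 : (k * R) ^ 2 = k ^ 2 * (u ^ 2 + v ^ 2 + 2 * u * v * k) := by
          rw [mul_pow, hRsq]
        nlinarith [mul_nonneg h7 (neg_nonneg.2 h6)]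
    calc _ ≤ Real.arccos (Real.cos L) := Real.arccos_le_arccos hle
      _ = L := Real.arccos_cos hL hpi.le
  · rcases lt_trichotomy (s * r₁ - (1 - s) * r₀) 0 with h | h | h
    · rw [Real.sign_of_neg h]; norm_num
    · rw [h, Real.sign_zero]; norm_num
    · rw [Real.sign_of_pos h]; norm_num

theorem interpPoint_mem (hΩ : Convex ℝ Ω) {s : ℝ} (hs : s ∈ Set.Icc (0 : ℝ) 1) (x₀ x₁ : Ω)
    {r₀ r₁ : ℝ} (h₀ : 0 ≤ r₀) (h₁ : 0 ≤ r₁)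
    (hR : interpRadius s (dist x₀ x₁) r₀ r₁ ≠ 0) :
    interpPoint s (x₀ : EuclideanSpace ℝ (Fin d)) x₁ r₀ r₁ ∈ Ω := by
  have h := interpRho_mem hs dist_nonneg h₀ h₁ hR
  exact hΩ x₀.2 x₁.2 (sub_nonneg.2 h.2) h.1 (by ring)

theorem interpRadius_zero_left {s : ℝ} (hs : 0 ≤ s) (L : ℝ) {r₁ : ℝ} (h₁ : 0 ≤ r₁) :
    interpRadius s L 0 r₁ = s * r₁ := by
  rw [← Real.sqrt_sq (mul_nonneg hs h₁), interpRadius]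
  congr 1
  ring

theorem interpRadius_zero_right {s : ℝ} (hs : s ≤ 1) (L : ℝ) {r₀ : ℝ} (h₀ : 0 ≤ r₀) :
    interpRadius s L r₀ 0 = (1 - s) * r₀ := by
  rw [← Real.sqrt_sq (mul_nonneg (sub_nonneg.2 hs) h₀), interpRadius]
  congr 1
  ring

theorem interpPoint_zero_left {s : ℝ} (hs : 0 ≤ s) (x₀ x₁ : EuclideanSpace ℝ (Fin d)) {r₁ : ℝ}
    (h₁ : 0 ≤ r₁) (h : s * r₁ ≠ 0) : interpPoint s x₀ x₁ 0 r₁ = x₁ := by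
  have hpos : 0 < s * r₁ := lt_of_le_of_ne (mul_nonneg hs h₁) h.symm
  unfold interpPoint interpRho
  rw [interpRadius_zero_left hs _ h₁]
  split_ifs with hpi
  · rw [mul_zero, zero_add, mul_div_cancel_left₀ _ h, Real.arccos_cos dist_nonneg hpi.le]
    by_cases hd : x₀ = x₁
    · simp [hd]
    · rw [one_div_mul_cancel (dist_ne_zero.2 hd)]
      simp
  · rw [mul_zero, sub_zero, Real.sign_of_pos hpos]
    norm_num

theorem interpPoint_zero_right {s : ℝ} (hs : s ≤ 1) (x₀ x₁ : EuclideanSpace ℝ (Fin d)) {r₀ : ℝ}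
    (h₀ : 0 ≤ r₀) (h : (1 - s) * r₀ ≠ 0) : interpPoint s x₀ x₁ r₀ 0 = x₀ := by
  have hpos : 0 < (1 - s) * r₀ := lt_of_le_of_ne (mul_nonneg (sub_nonneg.2 hs) h₀) h.symm
  unfold interpPoint interpRho
  rw [interpRadius_zero_right hs _ h₀]
  split_ifs with hpi
  · rw [mul_zero, zero_mul, add_zero, div_self h]
    simp
  · rw [mul_zero, zero_sub, Real.sign_of_neg (neg_lt_zero.2 hpos)]
    norm_num

theorem interpRadius_base (s : ℝ) (hs : s ∈ Set.Icc (0 : ℝ) 1) (x₀ x₁ : Ω) (r₀ r₁ : ℝ≥0) :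
    interpRadius s (dist (base (mk x₀ r₀)) (base (mk x₁ r₁))) r₀ r₁ =
      interpRadius s (dist x₀ x₁) r₀ r₁ := by
  by_cases h₀ : r₀ = 0
  · subst h₀
    rw [NNReal.coe_zero, interpRadius_zero_left hs.1 _ r₁.coe_nonneg,
      interpRadius_zero_left hs.1 _ r₁.coe_nonneg]
  by_cases h₁ : r₁ = 0
  · subst h₁
    rw [NNReal.coe_zero, interpRadius_zero_right hs.2 _ r₀.coe_nonneg,
      interpRadius_zero_right hs.2 _ r₀.coe_nonneg]
  rw [base_mk x₀ h₀, base_mk x₁ h₁]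

/-- The interpolator in arbitrary representatives, where `R(s) ≠ 0`. -/
theorem interp_mk (hΩ : Convex ℝ Ω) {s : ℝ} (hs : s ∈ Set.Icc (0 : ℝ) 1) (x₀ x₁ : Ω)
    (r₀ r₁ : ℝ≥0) (hR : interpRadius s (dist x₀ x₁) r₀ r₁ ≠ 0) :
    interp s (mk x₀ r₀) (mk x₁ r₁) =
      mk ⟨interpPoint s (x₀ : EuclideanSpace ℝ (Fin d)) x₁ r₀ r₁,
          interpPoint_mem hΩ hs x₀ x₁ r₀.coe_nonneg r₁.coe_nonneg hR⟩
        (interpRadius s (dist x₀ x₁) r₀ r₁).toNNReal := by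
  have hR' := hR
  rw [← interpRadius_base s hs] at hR'
  have hmem := interpPoint_mem hΩ hs (base (mk x₀ r₀)) (base (mk x₁ r₁)) r₀.coe_nonneg r₁.coe_nonneg hR'
  unfold interp
  simp only [radius_mk, interpRadius_base s hs]
  rw [toBase_of_mem _ hmem]
  congr 2
  by_cases h₀ : r₀ = 0
  · subst h₀
    rw [NNReal.coe_zero, interpRadius_zero_left hs.1 _ r₁.coe_nonneg] at hR
    have h₁ : r₁ ≠ 0 := fun h => hR (by simp [h])
    rw [NNReal.coe_zero, interpPoint_zero_left hs.1 _ _ r₁.coe_nonneg hR,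
      interpPoint_zero_left hs.1 _ _ r₁.coe_nonneg hR, base_mk x₁ h₁]
  by_cases h₁ : r₁ = 0
  · subst h₁
    rw [NNReal.coe_zero, interpRadius_zero_right hs.2 _ r₀.coe_nonneg] at hR
    rw [NNReal.coe_zero, interpPoint_zero_right hs.2 _ _ r₀.coe_nonneg hR,
      interpPoint_zero_right hs.2 _ _ r₀.coe_nonneg hR, base_mk x₀ h₀]
  rw [base_mk x₀ h₀, base_mk x₁ h₁]

/-- The interpolator in arbitrary representatives, where `R(s) = 0`. -/
theorem interp_mk_of_eq_zero {s : ℝ} (hs : s ∈ Set.Icc (0 : ℝ) 1) (x x₀ x₁ : Ω)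
    (r₀ r₁ : ℝ≥0) (hR : interpRadius s (dist x₀ x₁) r₀ r₁ = 0) :
    interp s (mk x₀ r₀) (mk x₁ r₁) = mk x 0 := by
  unfold interp
  simp only [radius_mk, interpRadius_base s hs, hR, Real.toNNReal_zero]
  exact mk_zero _ _

/-- For closed `Ω` the map `Z(s; ·, ·)` is Borel. -/
theorem measurable_interp (hΩ : IsClosed Ω) (s : ℝ) :
    Measurable fun p : Cone Ω × Cone Ω => interp s p.1 p.2 := by
  classical
  have hb₀ : Measurable fun p : Cone Ω × Cone Ω => base p.1 := measurable_base.comp measurable_fst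
  have hb₁ : Measurable fun p : Cone Ω × Cone Ω => base p.2 := measurable_base.comp measurable_snd
  have hr₀ : Measurable fun p : Cone Ω × Cone Ω => (radius p.1 : ℝ) :=
    (measurable_radius.comp measurable_fst).coe_nnreal_real
  have hr₁ : Measurable fun p : Cone Ω × Cone Ω => (radius p.2 : ℝ) :=
    (measurable_radius.comp measurable_snd).coe_nnreal_real
  have hL : Measurable fun p : Cone Ω × Cone Ω => dist (base p.1) (base p.2) := hb₀.dist hb₁
  have hcp : Measurable cosPi :=
    (Real.continuous_cos.comp (continuous_abs.min continuous_const)).measurable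
  have hR : Measurable fun p : Cone Ω × Cone Ω =>
      interpRadius s (dist (base p.1) (base p.2)) (radius p.1) (radius p.2) := by
    unfold interpRadius
    have := hcp.comp hL
    simp only [Function.comp_def] at this
    fun_prop
  have hsign : Measurable Real.sign := by
    unfold Real.sign
    exact Measurable.ite measurableSet_Iio measurable_const
      (Measurable.ite measurableSet_Ioi measurable_const measurable_const)
  have hrho : Measurable fun p : Cone Ω × Cone Ω =>
      interpRho s (dist (base p.1) (base p.2)) (radius p.1) (radius p.2) := by
    unfold interpRho
    refine Measurable.ite (measurableSet_lt hL measurable_const) ?_ ?_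
    · have := Real.continuous_arccos.measurable
      fun_prop
    · fun_prop
  have hX : Measurable fun p : Cone Ω × Cone Ω =>
      interpPoint s (base p.1 : EuclideanSpace ℝ (Fin d)) (base p.2) (radius p.1)
        (radius p.2) := by
    unfold interpPoint
    have h1 := hb₀.subtype_val
    have h2 := hb₁.subtype_val
    exact ((measurable_const.sub hrho).smul h1).add (hrho.smul h2)
  have hcoe : ∀ (x : Ω) (p : EuclideanSpace ℝ (Fin d)),
      ((toBase x p : Ω) : EuclideanSpace ℝ (Fin d)) = if p ∈ Ω then p else x := by
    intro x p
    by_cases h : p ∈ Ω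
    · rw [toBase_of_mem x h, if_pos h]
    · rw [toBase, dif_neg h, if_neg h]
  have hT : Measurable fun p : Cone Ω × Cone Ω => toBase (base p.1)
      (interpPoint s (base p.1 : EuclideanSpace ℝ (Fin d)) (base p.2) (radius p.1)
        (radius p.2)) := by
    refine (MeasurableEmbedding.subtype_coe hΩ.measurableSet).measurable_comp_iff.1 ?_
    simp only [Function.comp_def, hcoe]
    exact Measurable.ite (hX hΩ.measurableSet) hX hb₀.subtype_val
  exact measurable_mk.comp (hT.prodMk hR.real_toNNReal)

/-! ### Measures on the cone, the projection `𝔓`, and the Hellinger–Kantorovich distance -/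

/-- `λ ∈ M₂(C)`: a finite Borel measure with finite second moment `∫ r² dλ`. -/
def MemM2 (l : Measure (Cone Ω)) : Prop :=
  IsFiniteMeasure l ∧ ∫⁻ z, (radius z : ℝ≥0∞) ^ 2 ∂l < ∞

/-- The projection `𝔓λ`, i.e. the image under `[x,r] ↦ x` of the measure `r² λ`
(which does not charge the tip); see `integral_proj`. -/
def proj (l : Measure (Cone Ω)) : Measure Ω :=
  (l.withDensity fun z => ((radius z ^ 2 : ℝ≥0) : ℝ≥0∞)).map base

/-- `∫ φ d(𝔓λ) = ∫ r² φ(x) dλ([x,r])`. -/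
theorem integral_proj (l : Measure (Cone Ω)) (φ : C(Ω, ℝ)) :
    ∫ x, φ x ∂(proj l) = ∫ z, (radius z : ℝ) ^ 2 * φ (base z) ∂l := by
  unfold proj
  rw [integral_map measurable_base.aemeasurable φ.continuous.aestronglyMeasurable,
    integral_withDensity_eq_integral_smul (measurable_radius.pow_const 2)]
  simp [NNReal.smul_def]

/-- `γ` is a transport plan between `λ₀` and `λ₁`. -/
def IsPlan (l₀ l₁ : Measure (Cone Ω)) (γ : Measure (Cone Ω × Cone Ω)) : Prop :=
  γ.map Prod.fst = l₀ ∧ γ.map Prod.snd = l₁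

/-- The quadratic cost `∬ d(z₀,z₁)² dγ`. -/
def planCost (γ : Measure (Cone Ω × Cone Ω)) : ℝ≥0∞ :=
  ∫⁻ p, ENNReal.ofReal (coneDist p.1 p.2 ^ 2) ∂γ

/-- The Kantorovich–Wasserstein distance on the cone; it is `∞` if the masses differ, since
then there is no plan. -/
def wassersteinCone (l₀ l₁ : Measure (Cone Ω)) : ℝ≥0∞ :=
  (⨅ (γ : Measure (Cone Ω × Cone Ω)) (_ : IsPlan l₀ l₁ γ), planCost γ) ^ (1 / 2 : ℝ)

/-- `λ ∈ M₂(C)` is a lift of `μ`. -/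
def IsLift (l : Measure (Cone Ω)) (μ : Measure Ω) : Prop := MemM2 l ∧ proj l = μ

/-- The Hellinger–Kantorovich distance. -/
def HK (μ₀ μ₁ : Measure Ω) : ℝ≥0∞ :=
  ⨅ (l₀ : Measure (Cone Ω)) (l₁ : Measure (Cone Ω)) (_ : IsLift l₀ μ₀) (_ : IsLift l₁ μ₁),
    wassersteinCone l₀ l₁

/-- `λ₀, λ₁` are optimal lifts of `μ₀, μ₁`, and `γ` is an optimal plan between `λ₀, λ₁`. -/
def IsOptimal (μ₀ μ₁ : Measure Ω) (l₀ l₁ : Measure (Cone Ω))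
    (γ : Measure (Cone Ω × Cone Ω)) : Prop :=
  (IsLift l₀ μ₀ ∧ IsLift l₁ μ₁ ∧ wassersteinCone l₀ l₁ = HK μ₀ μ₁) ∧
    (IsPlan l₀ l₁ γ ∧ planCost γ = wassersteinCone l₀ l₁ ^ 2)

/-- `μ : [0,1] → M(Ω)` is a geodesic built from a cone plan: `μ(s) = 𝔓(Z(s;·,·)_# γ)` for an
optimal plan `γ` between optimal lifts of `μ₀` and `μ₁`. -/
def IsConePlanGeodesic (μ₀ μ₁ : Measure Ω) (μ : I → Measure Ω) : Prop :=
  ∃ (l₀ l₁ : Measure (Cone Ω)) (γ : Measure (Cone Ω × Cone Ω)), IsOptimal μ₀ μ₁ l₀ l₁ γ ∧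
    ∀ s : I, μ s = proj (γ.map fun p => interp (s : ℝ) p.1 p.2)

/-! ### Geodesic `Λ`-convexity -/

/-- `F` is `Λ`-convex along all HK-geodesics that are built from cone plans, between arbitrary
finite measures on `Ω`. -/
def ConvexAlongConePlanGeodesics (F : Measure Ω → ℝ) (Λ : ℝ) : Prop :=
  ∀ μ₀ μ₁ : Measure Ω, IsFiniteMeasure μ₀ → IsFiniteMeasure μ₁ →
    ∀ μ : I → Measure Ω, IsConePlanGeodesic μ₀ μ₁ μ → ∀ s : I,
      F (μ s) ≤ (1 - s) * F μ₀ + s * F μ₁ - Λ * (s * (1 - s) / 2) * (HK μ₀ μ₁).toReal ^ 2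

/-- `z : [0,1] → C` is a (constant-speed, minimal) geodesic of the cone. -/
def IsConeGeodesic (z : I → Cone Ω) : Prop :=
  ∀ s t : I, coneDist (z s) (z t) = |(s : ℝ) - t| * coneDist (z 0) (z 1)

/-- `f` is geodesically `Λ`-convex on the cone. -/
def GeodesicallyConvexOnCone (f : Cone Ω → ℝ) (Λ : ℝ) : Prop :=
  ∀ z : I → Cone Ω, IsConeGeodesic z → ∀ s : I,
    f (z s) ≤ (1 - s) * f (z 0) + s * f (z 1)
      - Λ * (s * (1 - s) / 2) * coneDist (z 0) (z 1) ^ 2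

/-- `F_Φ(μ) = ∫ Φ dμ`. -/
def potentialEnergy (Φ : C(Ω, ℝ)) (μ : Measure Ω) : ℝ := ∫ x, Φ x ∂μ

/-- `Φ̃([x,r]) = r² Φ(x)`. -/
def conePotential (Φ : C(Ω, ℝ)) (z : Cone Ω) : ℝ := (radius z : ℝ) ^ 2 * Φ (base z)

theorem conePotential_mk (Φ : C(Ω, ℝ)) (x : Ω) (r : ℝ≥0) :
    conePotential Φ (mk x r) = (r : ℝ) ^ 2 * Φ x := by
  unfold conePotential
  by_cases hr : r = 0
  · simp [hr]
  · rw [base_mk x hr, radius_mk]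

end HKCone

end

noncomputable section

namespace HKCone

variable {d : ℕ} {Ω : Set (EuclideanSpace ℝ (Fin d))}

/-! ### Trigonometry of the truncated cosine -/

/-! Convexity on the cone implies convexity of `F_Φ` by integration. For fixed endpoints the
interpolator `Z` is a cone geodesic (`isConeGeodesic_interp`), since `Z` is affine interpolation in
a planar sector (angle below `π`) or on a line through the tip (angle at least `π`). The pointwise
inequality is integrated against `γ`, and optimality turns `∫ d² dγ` into `HK²`.

For the converse, `F_Φ` is tested on Dirac masses. The plan `δ_(z₀,z₁)` is optimal when the angle is
at most `π/2` (`isOptimal_dirac`); beyond that, transport through the tip is cheaper. So only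
`ConvexAtAcuteAngles` is obtained directly, and every cone geodesic has to be recovered from it.

If both endpoints differ from the tip and their angle is below `π`, the geodesic stays away from the
tip. Short pieces of it then span acute angles and, by uniqueness of intermediate points
(`IsBetween.eq_interp`), coincide with interpolators. Since `Λ`-convexity on overlapping intervals
glues (`convexOn_Icc_of_short`), it holds on the whole geodesic.

In the remaining case an endpoint is the tip or the angle is at least `π`, and each intermediate
point is the tip or lies on the ray of an endpoint (`IsBetween.of_degenerate`). Acute convexity
along a single ray already gives `Φ ≥ Λ/2`. Because `r²` satisfies the `2`-convexity inequality with
equality along every geodesic, it only remains to treat `r² (Φ - Λ/2)`, which is nonnegative and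
quadratic on each ray. -/

theorem cosPi_of_le {a : ℝ} (h0 : 0 ≤ a) (h : a ≤ Real.pi) : cosPi a = Real.cos a := by
  rw [cosPi, abs_of_nonneg h0, min_eq_left h]

theorem cosPi_of_ge {a : ℝ} (h : Real.pi ≤ a) : cosPi a = -1 := by
  rw [cosPi, abs_of_nonneg (Real.pi_pos.le.trans h), min_eq_right h, Real.cos_pi]

theorem neg_one_le_cosPi (a : ℝ) : -1 ≤ cosPi a := Real.neg_one_le_cos _

theorem cosPi_le_one (a : ℝ) : cosPi a ≤ 1 := Real.cos_le_one _

theorem cosPi_anti {a b : ℝ} (h0 : 0 ≤ a) (h : a ≤ b) : cosPi b ≤ cosPi a := by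
  rw [cosPi, cosPi, abs_of_nonneg h0, abs_of_nonneg (h0.trans h)]
  exact Real.cos_le_cos_of_nonneg_of_le_pi (le_min h0 Real.pi_pos.le) (min_le_right _ _)
    (min_le_min_right _ h)

theorem eq_zero_of_cosPi_eq_one {a : ℝ} (h0 : 0 ≤ a) (h : cosPi a = 1) : a = 0 := by
  rcases le_total a Real.pi with ha | ha
  · rw [cosPi_of_le h0 ha] at h
    have hpi := Real.pi_pos
    exact (Real.cos_eq_one_iff_of_lt_of_lt (by linarith) (by linarith)).1 h
  · rw [cosPi_of_ge ha] at h
    norm_num at h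

theorem lt_pi_of_neg_one_lt_cosPi {a : ℝ} (h : -1 < cosPi a) : a < Real.pi := by
  by_contra hc
  rw [cosPi_of_ge (not_lt.1 hc)] at h
  exact lt_irrefl _ h

theorem sq_add_sq_add_cosPi_nonneg {u v : ℝ} (hu : 0 ≤ u) (hv : 0 ≤ v) (L : ℝ) :
    (u - v) ^ 2 ≤ u ^ 2 + v ^ 2 + 2 * u * v * cosPi L := by
  nlinarith [mul_nonneg (mul_nonneg hu hv) (neg_le_iff_add_nonneg.1 (neg_one_le_cosPi L))]

/-- The equality case of the planar triangle inequality in the cone, in terms of the weighted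
radii `u = (1 - s) r₀` and `v = s r₁`. -/
theorem middle_point_equations {L L₀ L₁ u v r : ℝ} (hL : 0 ≤ L) (hL₀ : 0 ≤ L₀) (hL₁ : 0 ≤ L₁)
    (hu : 0 ≤ u) (hv : 0 ≤ v) (hr : 0 ≤ r) (htri : L ≤ L₀ + L₁)
    (h : r ^ 2 - 2 * r * (u * cosPi L₀ + v * cosPi L₁)
      + (u ^ 2 + v ^ 2 + 2 * u * v * cosPi L) ≤ 0) :
    r ^ 2 = u ^ 2 + v ^ 2 + 2 * u * v * cosPi L ∧
      ((L₀ + L₁ < Real.pi ∧ r = u * Real.cos L₀ + v * Real.cos L₁ ∧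
          u * Real.sin L₀ = v * Real.sin L₁ ∧ u * v * (cosPi L - Real.cos (L₀ + L₁)) = 0) ∨
        (cosPi L₀ + cosPi L₁ ≤ 0 ∧ u * v * (1 + cosPi L) = 0 ∧ r = |u - v| ∧
          r * (u * cosPi L₀ + v * cosPi L₁) = r ^ 2)) := by
  have huv := mul_nonneg hu hv
  have hanti := cosPi_anti hL htri
  rcases lt_or_ge (L₀ + L₁) Real.pi with hpi | hpi
  · rw [cosPi_of_le hL₀ (by linarith), cosPi_of_le hL₁ (by linarith)] at h
    rw [cosPi_of_le (by linarith) hpi.le] at hanti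
    -- Unfolded in the plane, the left side of `h` is a sum of two squares and a nonnegative angular
    -- defect; hence all three vanish.
    have key : (r - (u * Real.cos L₀ + v * Real.cos L₁)) ^ 2
        + (u * Real.sin L₀ - v * Real.sin L₁) ^ 2
        + 2 * (u * v * (cosPi L - Real.cos (L₀ + L₁))) ≤ 0 := by
      rw [Real.cos_add]
      refine le_trans (le_of_eq ?_) h
      linear_combination u ^ 2 * Real.sin_sq_add_cos_sq L₀ + v ^ 2 * Real.sin_sq_add_cos_sq L₁
    have k3 := mul_nonneg huv (sub_nonneg.2 hanti)
    have e3 : u * v * (cosPi L - Real.cos (L₀ + L₁)) = 0 := by nlinarith [sq_nonneg (r - (u * Real.cos L₀ + v * Real.cos L₁)), sq_nonneg (u * Real.sin L₀ - v * Real.sin L₁)]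
    have e1 : r - (u * Real.cos L₀ + v * Real.cos L₁) = 0 := by
      rw [← sq_eq_zero_iff]
      nlinarith [sq_nonneg (r - (u * Real.cos L₀ + v * Real.cos L₁)), sq_nonneg (u * Real.sin L₀ - v * Real.sin L₁)]
    have e2 : u * Real.sin L₀ - v * Real.sin L₁ = 0 := by
      rw [← sq_eq_zero_iff]
      nlinarith [sq_nonneg (r - (u * Real.cos L₀ + v * Real.cos L₁)), sq_nonneg (u * Real.sin L₀ - v * Real.sin L₁)]
    refine ⟨?_, Or.inl ⟨hpi, by linarith, by linarith, e3⟩⟩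
    rw [sub_eq_zero] at e1 e2
    rw [Real.cos_add] at e3
    rw [e1]
    linear_combination (-2) * e3 + u ^ 2 * Real.sin_sq_add_cos_sq L₀
      + v ^ 2 * Real.sin_sq_add_cos_sq L₁ - (u * Real.sin L₀ - v * Real.sin L₁) * e2
  · have hc : cosPi L₀ + cosPi L₁ ≤ 0 := by
      rcases le_total Real.pi L₀ with h0 | h0
      · rw [cosPi_of_ge h0]; linarith [cosPi_le_one L₁]
      · have := cosPi_anti (a := Real.pi - L₀) (b := L₁) (by linarith) (by linarith)
        rw [cosPi_of_le (a := Real.pi - L₀) (by linarith) (by linarith), Real.cos_pi_sub] at this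
        rw [cosPi_of_le hL₀ h0]
        linarith
    -- With `cosPi L₀ + cosPi L₁ ≤ 0`, the smaller weight can be traded against the larger one. The
    -- left side of `h` is then at least `(r - |u - v|)² + 2uv(1 + cosPi L)`, so both terms vanish.
    have hm : u * cosPi L₀ + v * cosPi L₁ ≤ |u - v| := by
      have a0 := cosPi_le_one L₀
      have a1 := cosPi_le_one L₁
      rcases le_total u v with huv' | huv'
      · rw [abs_of_nonpos (by linarith)]
        nlinarith
      · rw [abs_of_nonneg (by linarith)]
        nlinarith
    have hm' := mul_le_mul_of_nonneg_left hm hr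
    have hk := mul_nonneg huv (neg_le_iff_add_nonneg.1 (neg_one_le_cosPi L))
    have hsq := sq_abs (u - v)
    have hs := sq_nonneg (r - |u - v|)
    have e1 : u * v * (cosPi L + 1) = 0 := by nlinarith
    have e2 : r - |u - v| = 0 := by
      rw [← sq_eq_zero_iff]; nlinarith
    rw [sub_eq_zero] at e2
    refine ⟨?_, Or.inr ⟨hc, by linarith, e2, ?_⟩⟩
    · rw [e2, hsq]; linarith
    · rw [← e2] at hm' hsq
      nlinarith

/-! ### Gluing of convexity -/

/-- Convexity is monotonicity of adjacent slopes. At a point `y` of the overlap `(p, q)`, the outer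
points are pulled into the overlap, where `h₁` compares the slopes, while `h₁` and `h₂` control the
change of slope on either side. For `y` outside the overlap, an auxiliary point `m` of the overlap
is inserted when the outer interval crosses it. -/
theorem convexOn_Icc_glue {f : ℝ → ℝ} {a b p q : ℝ} (hap : a ≤ p) (hpq : p < q) (hqb : q ≤ b)
    (h₁ : ConvexOn ℝ (Set.Icc a q) f) (h₂ : ConvexOn ℝ (Set.Icc p b) f) :
    ConvexOn ℝ (Set.Icc a b) f := by
  have mid : ∀ x y z, a ≤ x → z ≤ b → x < y → y < z → p < y → y < q →
      (f y - f x) / (y - x) ≤ (f z - f y) / (z - y) := by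
    intro x y z hx hz hxy hyz hpy hyq
    have hx' : max x p < y := max_lt hxy hpy
    have hz' : y < min z q := lt_min hyz hyq
    have m := h₁.slope_mono_adjacent (x := max x p) (y := y) (z := min z q)
      ⟨hx.trans (le_max_left _ _), by linarith⟩ ⟨by linarith, min_le_right _ _⟩ hx' hz'
    have l : (f y - f x) / (y - x) ≤ (f y - f (max x p)) / (y - max x p) := by
      rcases le_or_gt p x with hpx | hpx
      · rw [max_eq_left hpx]
      · rw [max_eq_right hpx.le]
        have := h₁.secant_mono (a := y) (x := x) (y := p) ⟨by linarith, by linarith⟩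
          ⟨hx, by linarith⟩ ⟨hap, by linarith⟩ (by linarith) (by linarith) hpx.le
        rw [← neg_sub (f y) (f x), ← neg_sub y x, ← neg_sub (f y) (f p), ← neg_sub y p,
          neg_div_neg_eq, neg_div_neg_eq] at this
        exact this
    have r : (f (min z q) - f y) / (min z q - y) ≤ (f z - f y) / (z - y) := by
      rcases le_or_gt z q with hzq | hzq
      · rw [min_eq_left hzq]
      · rw [min_eq_right hzq.le]
        exact h₂.secant_mono (a := y) (x := q) (y := z) ⟨by linarith, by linarith⟩
          ⟨by linarith, hqb⟩ ⟨by linarith, hz⟩ (by linarith) (by linarith) hzq.le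
    exact l.trans (m.trans r)
  refine convexOn_of_slope_mono_adjacent (convex_Icc a b) ?_
  rintro x y z ⟨hx, -⟩ ⟨-, hz⟩ hxy hyz
  rcases le_or_gt y p with hyp | hyp
  · rcases le_or_gt z q with hzq | hzq
    · exact h₁.slope_mono_adjacent ⟨hx, by linarith⟩ ⟨by linarith, hzq⟩ hxy hyz
    · obtain ⟨m, hm, hm'⟩ := exists_between hpq
      have k1 := h₁.slope_mono_adjacent (x := x) (y := y) (z := m) ⟨hx, by linarith⟩
        ⟨by linarith, hm'.le⟩ hxy (by linarith)
      have k2 := mid y m z (by linarith) hz (by linarith) (by linarith) hm hm'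
      refine k1.trans ?_
      rw [div_le_div_iff₀ (by linarith) (by linarith)] at k2 ⊢
      nlinarith
  · rcases lt_or_ge y q with hyq | hyq
    · exact mid x y z hx hz hxy hyz hyp hyq
    · rcases le_or_gt p x with hpx | hpx
      · exact h₂.slope_mono_adjacent ⟨hpx, by linarith⟩ ⟨by linarith, hz⟩ hxy hyz
      · obtain ⟨m, hm, hm'⟩ := exists_between hpq
        have k1 := h₂.slope_mono_adjacent (x := m) (y := y) (z := z) ⟨hm.le, by linarith⟩
          ⟨by linarith, hz⟩ (by linarith) hyz
        have k2 := mid x m y hx (by linarith) (by linarith) (by linarith) hm hm'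
        refine le_trans ?_ k1
        rw [div_le_div_iff₀ (by linarith) (by linarith)] at k2 ⊢
        nlinarith

theorem convexOn_Icc_of_short {f : ℝ → ℝ} {δ b : ℝ} (hδ : 0 < δ)
    (h : ∀ x y, 0 ≤ x → x ≤ y → y ≤ b → y ≤ x + δ → ConvexOn ℝ (Set.Icc x y) f) (hb : 0 ≤ b) :
    ConvexOn ℝ (Set.Icc 0 b) f := by
  have step : ∀ n : ℕ, ∀ y, 0 ≤ y → y ≤ b → y ≤ δ + n * (δ / 2) →
      ConvexOn ℝ (Set.Icc 0 y) f := by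
    intro n
    induction n with
    | zero =>
      intro y h0 hyb hy
      exact h 0 y le_rfl h0 hyb (by simpa using hy)
    | succ n ih =>
      intro y h0 hyb hy
      push_cast at hy
      rcases le_or_gt y δ with hyδ | hyδ
      · exact h 0 y le_rfl h0 hyb (by simpa using hyδ)
      -- Each step advances by `δ / 2` with a window of length `δ`, which leaves an overlap of
      -- length `δ / 2`.
      · exact convexOn_Icc_glue (p := y - δ) (q := y - δ / 2) (by linarith) (by linarith)
          (by linarith) (ih _ (by linarith) (by linarith) (by linarith))
          (h _ _ (by linarith) (by linarith) hyb (by linarith))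
  obtain ⟨n, hn⟩ := exists_nat_ge (b / (δ / 2))
  rw [div_le_iff₀ (by linarith)] at hn
  exact step n b hb le_rfl (by linarith)

/-! ### The cone distance -/

theorem coneDist_nonneg (z₀ z₁ : Cone Ω) : 0 ≤ coneDist z₀ z₁ := Real.sqrt_nonneg _

theorem coneDist_sq (z₀ z₁ : Cone Ω) : coneDist z₀ z₁ ^ 2 =
    (radius z₀ : ℝ) ^ 2 + (radius z₁ : ℝ) ^ 2
      - 2 * radius z₀ * radius z₁ * cosPi (dist (base z₀) (base z₁)) := by
  refine Real.sq_sqrt ?_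
  nlinarith [mul_nonneg (mul_nonneg (radius z₀).coe_nonneg (radius z₁).coe_nonneg)
    (sub_nonneg.2 (cosPi_le_one (dist (base z₀) (base z₁)))),
    sq_nonneg ((radius z₀ : ℝ) - radius z₁)]

theorem interpRadius_sq {s L r₀ r₁ : ℝ} (hs : s ∈ Set.Icc (0 : ℝ) 1) (h₀ : 0 ≤ r₀)
    (h₁ : 0 ≤ r₁) : interpRadius s L r₀ r₁ ^ 2 =
      ((1 - s) * r₀) ^ 2 + (s * r₁) ^ 2 + 2 * ((1 - s) * r₀) * (s * r₁) * cosPi L := by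
  have := sq_add_sq_add_cosPi_nonneg (mul_nonneg (sub_nonneg.2 hs.2) h₀)
    (mul_nonneg hs.1 h₁) L
  rw [interpRadius, Real.sq_sqrt]
  · ring
  · refine (sq_nonneg _).trans (this.trans (le_of_eq ?_))
    ring

theorem interpRadius_nonneg (s L r₀ r₁ : ℝ) : 0 ≤ interpRadius s L r₀ r₁ := Real.sqrt_nonneg _

/-- A point `w` divides the pair `z₀, z₁` in the ratio `s : 1 - s`. -/
def IsBetween (s : ℝ) (z₀ w z₁ : Cone Ω) : Prop :=
  coneDist z₀ w = s * coneDist z₀ z₁ ∧ coneDist w z₁ = (1 - s) * coneDist z₀ z₁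

theorem IsBetween.equations {s : ℝ} (hs : s ∈ Set.Icc (0 : ℝ) 1) {z₀ w z₁ : Cone Ω}
    (h : IsBetween s z₀ w z₁) {u v : ℝ} (hu : u = (1 - s) * radius z₀) (hv : v = s * radius z₁) :
    (radius w : ℝ) ^ 2 = u ^ 2 + v ^ 2 + 2 * u * v * cosPi (dist (base z₀) (base z₁)) ∧
      ((dist (base z₀) (base w) + dist (base w) (base z₁) < Real.pi ∧
          (radius w : ℝ) = u * Real.cos (dist (base z₀) (base w))
            + v * Real.cos (dist (base w) (base z₁)) ∧
          u * Real.sin (dist (base z₀) (base w)) = v * Real.sin (dist (base w) (base z₁)) ∧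
          u * v * (cosPi (dist (base z₀) (base z₁))
            - Real.cos (dist (base z₀) (base w) + dist (base w) (base z₁))) = 0) ∨
        (cosPi (dist (base z₀) (base w)) + cosPi (dist (base w) (base z₁)) ≤ 0 ∧
          u * v * (1 + cosPi (dist (base z₀) (base z₁))) = 0 ∧ (radius w : ℝ) = |u - v| ∧
          radius w * (u * cosPi (dist (base z₀) (base w)) + v * cosPi (dist (base w) (base z₁)))
            = (radius w : ℝ) ^ 2)) := by
  refine middle_point_equations dist_nonneg dist_nonneg dist_nonneg
    (hu ▸ mul_nonneg (sub_nonneg.2 hs.2) (radius z₀).coe_nonneg)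
    (hv ▸ mul_nonneg hs.1 (radius z₁).coe_nonneg) (radius w).coe_nonneg (dist_triangle _ _ _) ?_
  have h0 := congrArg (· ^ 2) h.1
  have h1 := congrArg (· ^ 2) h.2
  simp only [mul_pow, coneDist_sq] at h0 h1
  rw [hu, hv]
  refine le_of_eq ?_
  -- With these weights the squared distances sum to `s(1 - s) d(z₀,z₁)²`, the value in the
  -- Euclidean identity for a point dividing a segment.
  linear_combination (1 - s) * h0 + s * h1

/-- A point between two points whose bases are at least `π` apart, or one of which is the tip. -/
theorem IsBetween.of_degenerate {s : ℝ} (hs : s ∈ Set.Icc (0 : ℝ) 1) {z₀ w z₁ : Cone Ω}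
    (h : IsBetween s z₀ w z₁)
    (hdeg : (radius z₀ : ℝ) * radius z₁ * (1 + cosPi (dist (base z₀) (base z₁))) = 0) :
    radius w = 0 ∨ (base w = base z₀ ∧ (radius w : ℝ) ≤ (1 - s) * radius z₀) ∨
      (base w = base z₁ ∧ (radius w : ℝ) ≤ s * radius z₁) := by
  by_cases hr : radius w = 0
  · exact Or.inl hr
  right
  have hr' : 0 < (radius w : ℝ) := lt_of_le_of_ne (radius w).coe_nonneg (by exact_mod_cast Ne.symm hr)
  obtain ⟨hsq, heq⟩ := h.equations hs rfl rfl
  have hu := mul_nonneg (sub_nonneg.2 hs.2) (radius z₀).coe_nonneg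
  have hv := mul_nonneg hs.1 (radius z₁).coe_nonneg
  have hdeg' : (1 - s) * (radius z₀ : ℝ) * (s * radius z₁)
      * (1 + cosPi (dist (base z₀) (base z₁))) = 0 := by
    linear_combination (1 - s) * s * hdeg
  have tri := dist_triangle (base z₀) (base w) (base z₁)
  have d0 : 0 ≤ dist (base z₀) (base w) := dist_nonneg
  have d1 : 0 ≤ dist (base w) (base z₁) := dist_nonneg
  generalize (1 - s) * (radius z₀ : ℝ) = u at *
  generalize s * (radius z₁ : ℝ) = v at *
  have fin0 : dist (base z₀) (base w) = 0 → base w = base z₀ := fun h => (dist_eq_zero.1 h).symm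
  have fin1 : dist (base w) (base z₁) = 0 → base w = base z₁ := fun h => dist_eq_zero.1 h
  rcases heq with ⟨hpi, e1, e2, -⟩ | ⟨hc, -, e1, e2⟩
  -- Here the angle of the endpoints is below `π`, so degeneracy means that one weight vanishes; the
  -- sine equation then puts `w` on the other ray.
  · have hlt : -1 < cosPi (dist (base z₀) (base z₁)) := by
      rw [cosPi_of_le dist_nonneg (by linarith), ← Real.cos_pi]
      exact Real.cos_lt_cos_of_nonneg_of_le_pi dist_nonneg le_rfl (by linarith)
    have huv : u * v = 0 := (mul_eq_zero.1 hdeg').resolve_right (by linarith)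
    have sin0 : ∀ x : ℝ, 0 ≤ x → x < Real.pi → Real.sin x = 0 → x = 0 := fun x hx hx' h =>
      (Real.sin_eq_zero_iff_of_lt_of_lt (by linarith) hx').1 h
    rcases mul_eq_zero.1 huv with h0 | h0
    · right
      rw [h0, zero_mul, zero_add] at e1
      rw [h0, zero_mul] at e2
      have hv0 : v ≠ 0 := fun h => by rw [h, zero_mul] at e1; linarith
      refine ⟨fin1 (sin0 _ d1 (by linarith) ((mul_eq_zero.1 e2.symm).resolve_left hv0)), ?_⟩
      rw [e1]
      nlinarith [Real.cos_le_one (dist (base w) (base z₁))]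
    · left
      rw [h0, zero_mul, add_zero] at e1
      rw [h0, zero_mul] at e2
      have hv0 : u ≠ 0 := fun h => by rw [h, zero_mul] at e1; linarith
      refine ⟨fin0 (sin0 _ d0 (by linarith) ((mul_eq_zero.1 e2).resolve_left hv0)), ?_⟩
      rw [e1]
      nlinarith [Real.cos_le_one (dist (base z₀) (base w))]
  -- The radius `|u - v|` is positive, so equality in `u cosPi L₀ + v cosPi L₁ ≤ |u - v|` forces the
  -- cosine at the endpoint with the larger weight to be `1`.
  · have e3 : u * cosPi (dist (base z₀) (base w)) + v * cosPi (dist (base w) (base z₁))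
        = |u - v| := by
      rw [← e1]
      refine mul_left_cancel₀ hr'.ne' ?_
      rw [e2, sq]
    have c0 := cosPi_le_one (dist (base z₀) (base w))
    have c1 := cosPi_le_one (dist (base w) (base z₁))
    rcases le_total u v with huv | huv
    · right
      rw [abs_of_nonpos (by linarith)] at e1 e3
      refine ⟨fin1 (eq_zero_of_cosPi_eq_one dist_nonneg (le_antisymm c1 ?_)), by linarith⟩
      by_contra hlt
      nlinarith [mul_pos (a := v - u) (by linarith) (sub_pos.2 (not_le.1 hlt))]
    · left
      rw [abs_of_nonneg (by linarith)] at e1 e3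
      refine ⟨fin0 (eq_zero_of_cosPi_eq_one dist_nonneg (le_antisymm c0 ?_)), by linarith⟩
      by_contra hlt
      nlinarith [mul_pos (a := u - v) (by linarith) (sub_pos.2 (not_le.1 hlt))]

/-- Uniqueness of the intermediate points between two points with bases less than `π` apart. -/
theorem IsBetween.eq_interp {s : ℝ} (hs : s ∈ Set.Ioo (0 : ℝ) 1) {z₀ w z₁ : Cone Ω}
    (h : IsBetween s z₀ w z₁) (h₀ : 0 < (radius z₀ : ℝ)) (h₁ : 0 < (radius z₁ : ℝ))
    (hpi : dist (base z₀) (base z₁) < Real.pi) : w = interp s z₀ z₁ := by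
  have hs' := Set.Ioo_subset_Icc_self hs
  obtain ⟨hsq, heq⟩ := h.equations hs' rfl rfl
  have hR : interpRadius s (dist (base z₀) (base z₁)) (radius z₀) (radius z₁) = radius w := by
    rw [← sq_eq_sq₀ (interpRadius_nonneg _ _ _ _) (radius w).coe_nonneg,
      interpRadius_sq hs' h₀.le h₁.le, hsq]
  have hu : 0 < (1 - s) * (radius z₀ : ℝ) := mul_pos (sub_pos.2 hs.2) h₀
  have hv : 0 < s * (radius z₁ : ℝ) := mul_pos hs.1 h₁
  have huv := mul_pos hu hv
  have hc := cosPi_of_le (a := dist (base z₀) (base z₁)) dist_nonneg hpi.le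
  have hlt : -1 < cosPi (dist (base z₀) (base z₁)) := by
    rw [hc, ← Real.cos_pi]
    exact Real.cos_lt_cos_of_nonneg_of_le_pi dist_nonneg le_rfl hpi
  have hr : 0 < (radius w : ℝ) := by
    refine lt_of_le_of_ne (radius w).coe_nonneg fun h => ?_
    rw [← h] at hsq
    nlinarith [sq_nonneg ((1 - s) * (radius z₀ : ℝ) - s * (radius z₁ : ℝ))]
  rcases heq with ⟨hlt', e1, e2, e3⟩ | ⟨-, e1, -, -⟩
  · have d0 : 0 ≤ dist (base z₀) (base w) := dist_nonneg
    have d1 : 0 ≤ dist (base w) (base z₁) := dist_nonneg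
    have e4 := (mul_eq_zero.1 e3).resolve_left huv.ne'
    rw [hc, sub_eq_zero] at e4
    -- Additivity of the angles puts `base w` on the segment between the bases, by strict convexity
    -- of the Euclidean norm.
    have hL := Real.injOn_cos ⟨dist_nonneg, hpi.le⟩ ⟨by linarith, hlt'.le⟩ e4
    have hcos : ((1 - s) * radius z₀ + s * radius z₁ * Real.cos (dist (base z₀) (base z₁)))
        / (radius w : ℝ) = Real.cos (dist (base z₀) (base w)) := by
      rw [div_eq_iff hr.ne', hL, Real.cos_add, e1]
      linear_combination Real.sin (dist (base z₀) (base w)) * e2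
        - (1 - s) * (radius z₀ : ℝ) * Real.sin_sq_add_cos_sq (dist (base z₀) (base w))
    have hX : interpPoint s (base z₀ : EuclideanSpace ℝ (Fin d)) (base z₁) (radius z₀)
        (radius z₁) = base w := by
      have hd : dist (base z₀ : EuclideanSpace ℝ (Fin d)) (base z₁)
        = dist (base z₀) (base z₁) := rfl
      have hrho : interpRho s (dist (base z₀) (base z₁)) (radius z₀) (radius z₁)
          = 1 / dist (base z₀) (base z₁) * dist (base z₀) (base w) := by
        rw [interpRho, if_pos hpi, hR, hcos, Real.arccos_cos d0 (by linarith)]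
      rw [interpPoint, hd, hrho]
      have hw : Wbtw ℝ (base z₀ : EuclideanSpace ℝ (Fin d)) (base w) (base z₁) :=
        dist_add_dist_eq_iff.1 hL.symm
      obtain ⟨t, ht, hwt⟩ := hw
      rw [AffineMap.lineMap_apply_module] at hwt
      rcases (dist_nonneg : 0 ≤ dist (base z₀) (base z₁)).eq_or_lt with h0 | h0
      · have hz : (base z₀ : EuclideanSpace ℝ (Fin d)) = base z₁ := dist_eq_zero.1 h0.symm
        have hz' : (base z₀ : EuclideanSpace ℝ (Fin d)) = base w :=
          dist_eq_zero.1 (show dist (base z₀) (base w) = 0 by linarith)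
        rw [← h0, ← hz, hz']
        simp
      · have : dist (base z₀) (base w) = t * dist (base z₀) (base z₁) := by
          change dist (base z₀ : EuclideanSpace ℝ (Fin d)) (base w)
            = t * dist (base z₀ : EuclideanSpace ℝ (Fin d)) (base z₁)
          rw [← hwt, ← AffineMap.lineMap_apply_module, dist_left_lineMap, Real.norm_of_nonneg ht.1]
        rw [this, ← hwt, one_div, mul_comm t, inv_mul_cancel_left₀ h0.ne']
    unfold interp
    rw [hX, hR, toBase_of_mem _ (base w).2, Real.toNNReal_coe]
    exact (mk_base_radius w).symm
  · exact absurd e1 (mul_pos huv (by linarith)).ne'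

/-! ### The interpolator is a geodesic -/

/-- Polar coordinates of the interpolated point for `L < π`. -/
theorem interp_polar {s L r₀ r₁ : ℝ} (hs : s ∈ Set.Icc (0 : ℝ) 1) (hL : 0 ≤ L)
    (hpi : L < Real.pi) (h₀ : 0 ≤ r₀) (h₁ : 0 ≤ r₁) :
    interpRadius s L r₀ r₁ * Real.cos (interpRho s L r₀ r₁ * L)
        = (1 - s) * r₀ + s * r₁ * Real.cos L ∧
      interpRadius s L r₀ r₁ * Real.sin (interpRho s L r₀ r₁ * L) = s * r₁ * Real.sin L ∧
      interpRho s L r₀ r₁ * L ∈ Set.Icc 0 Real.pi := by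
  have hRsq := interpRadius_sq (L := L) hs h₀ h₁
  have hR := interpRadius_nonneg s L r₀ r₁
  have hu := mul_nonneg (sub_nonneg.2 hs.2) h₀
  have hv := mul_nonneg hs.1 h₁
  rw [cosPi_of_le hL hpi.le] at hRsq
  rcases hL.eq_or_lt with rfl | hL'
  · simp only [Real.cos_zero, mul_zero, Real.sin_zero, mul_one, Set.left_mem_Icc,
      Real.pi_pos.le, and_true]
    rw [← sq_eq_sq₀ hR (add_nonneg hu hv), hRsq, Real.cos_zero]
    ring
  have hrho : interpRho s L r₀ r₁ * L
      = Real.arccos (((1 - s) * r₀ + s * r₁ * Real.cos L) / interpRadius s L r₀ r₁) := by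
    rw [interpRho, if_pos hpi, one_div, mul_comm, mul_inv_cancel_left₀ hL'.ne']
  rw [hrho]
  generalize interpRadius s L r₀ r₁ = R at *
  generalize (1 - s) * r₀ = u at *
  generalize s * r₁ = v at *
  have hsin : 0 ≤ Real.sin L := Real.sin_nonneg_of_nonneg_of_le_pi hL hpi.le
  have hid : R ^ 2 = (u + v * Real.cos L) ^ 2 + (v * Real.sin L) ^ 2 := by
    rw [hRsq]
    linear_combination (-v ^ 2) * Real.sin_sq_add_cos_sq L
  -- This puts the argument of `arccos` in `[-1, 1]`, so no truncation occurs. For `R = 0` the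
  -- quotient is a default value, and both planar coordinates vanish.
  have hle : |u + v * Real.cos L| ≤ R := abs_le_of_sq_le_sq (by nlinarith) hR
  refine ⟨?_, ?_, Real.arccos_nonneg _, Real.arccos_le_pi _⟩
  · rcases hR.eq_or_lt with h0 | h0
    · rw [← h0] at hle
      rw [← h0, zero_mul, abs_nonpos_iff.1 hle]
    · rw [Real.cos_arccos, mul_div_cancel₀ _ h0.ne']
      · rw [le_div_iff₀ h0]; linarith [(abs_le.1 hle).1]
      · rw [div_le_iff₀ h0]; linarith [(abs_le.1 hle).2]
  · rcases hR.eq_or_lt with h0 | h0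
    · rw [← h0] at hid
      rw [← h0, zero_mul]
      have : (v * Real.sin L) ^ 2 = 0 := by nlinarith [sq_nonneg (u + v * Real.cos L), sq_nonneg (v * Real.sin L)]
      exact (sq_eq_zero_iff.1 this).symm
    · rw [Real.sin_arccos, ← sq_eq_sq₀ (by positivity) (mul_nonneg hv hsin), mul_pow,
        Real.sq_sqrt]
      · field_simp
        linarith
      · rw [sub_nonneg, div_pow, div_le_one (by positivity)]
        nlinarith [sq_nonneg (v * Real.sin L)]

/-- The cone analogue of the inner product of two interpolated points. -/
theorem interp_inner {s t L r₀ r₁ : ℝ} (hs : s ∈ Set.Icc (0 : ℝ) 1)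
    (ht : t ∈ Set.Icc (0 : ℝ) 1) (hL : 0 ≤ L) (h₀ : 0 ≤ r₀) (h₁ : 0 ≤ r₁) :
    interpRadius s L r₀ r₁ * interpRadius t L r₀ r₁
        * cosPi (|interpRho s L r₀ r₁ - interpRho t L r₀ r₁| * L) =
      (1 - s) * r₀ * ((1 - t) * r₀) + s * r₁ * (t * r₁)
        + ((1 - s) * r₀ * (t * r₁) + (1 - t) * r₀ * (s * r₁)) * cosPi L := by
  rcases lt_or_ge L Real.pi with hpi | hpi
  · obtain ⟨a1, a2, a3⟩ := interp_polar hs hL hpi h₀ h₁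
    obtain ⟨b1, b2, b3⟩ := interp_polar ht hL hpi h₀ h₁
    have hang : |interpRho s L r₀ r₁ - interpRho t L r₀ r₁| * L
        = |interpRho s L r₀ r₁ * L - interpRho t L r₀ r₁ * L| := by
      rw [← sub_mul, abs_mul, abs_of_nonneg hL]
    rw [hang, cosPi_of_le (abs_nonneg _) (abs_le.2 ⟨by linarith [a3.1, b3.2],
      by linarith [a3.2, b3.1]⟩), cosPi_of_le hL hpi.le, Real.cos_abs, Real.cos_sub]
    generalize interpRho s L r₀ r₁ * L = θ at *
    generalize interpRho t L r₀ r₁ * L = η at *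
    calc _ = (interpRadius s L r₀ r₁ * Real.cos θ) * (interpRadius t L r₀ r₁ * Real.cos η)
          + (interpRadius s L r₀ r₁ * Real.sin θ) * (interpRadius t L r₀ r₁ * Real.sin η) := by
          ring
      _ = _ := by
          rw [a1, a2, b1, b2]
          linear_combination s * r₁ * (t * r₁) * Real.sin_sq_add_cos_sq L
  · have hrad : ∀ {x : ℝ}, x ∈ Set.Icc (0 : ℝ) 1 →
        interpRadius x L r₀ r₁ = |x * r₁ - (1 - x) * r₀| := by
      intro x hx
      rw [← sq_eq_sq₀ (interpRadius_nonneg _ _ _ _) (abs_nonneg _), interpRadius_sq hx h₀ h₁,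
        sq_abs, cosPi_of_ge hpi]
      ring
    have h1 : cosPi 0 = 1 := by rw [cosPi_of_le le_rfl Real.pi_pos.le, Real.cos_zero]
    rw [hrad hs, hrad ht, interpRho, if_neg hpi.not_gt, interpRho, if_neg hpi.not_gt,
      cosPi_of_ge hpi]
    have hrw : (1 - s) * r₀ * ((1 - t) * r₀) + s * r₁ * (t * r₁)
        + ((1 - s) * r₀ * (t * r₁) + (1 - t) * r₀ * (s * r₁)) * -1
        = (s * r₁ - (1 - s) * r₀) * (t * r₁ - (1 - t) * r₀) := by ring
    rw [hrw]
    -- `α` and `β` are signed coordinates on the line formed by the two rays. Equal signs give angle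
    -- `0`, opposite signs give angle `L ≥ π`, and a zero coordinate makes the product vanish.
    generalize s * r₁ - (1 - s) * r₀ = α
    generalize t * r₁ - (1 - t) * r₀ = β
    rcases lt_trichotomy α 0 with hα | hα | hα <;> rcases lt_trichotomy β 0 with hβ | hβ | hβ <;>
      simp [hα, hβ, Real.sign_of_neg, Real.sign_of_pos, abs_of_neg, abs_of_pos, h1] <;>
      norm_num [h1, cosPi_of_ge hpi]

theorem radius_interp (s : ℝ) (z₀ z₁ : Cone Ω) : (radius (interp s z₀ z₁) : ℝ) =
    interpRadius s (dist (base z₀) (base z₁)) (radius z₀) (radius z₁) := by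
  unfold interp
  rw [radius_mk, Real.coe_toNNReal _ (interpRadius_nonneg _ _ _ _)]

theorem base_interp (hΩ : Convex ℝ Ω) {s : ℝ} (hs : s ∈ Set.Icc (0 : ℝ) 1) {z₀ z₁ : Cone Ω}
    (h : radius (interp s z₀ z₁) ≠ 0) :
    (base (interp s z₀ z₁) : EuclideanSpace ℝ (Fin d)) =
      interpPoint s (base z₀ : EuclideanSpace ℝ (Fin d)) (base z₁) (radius z₀) (radius z₁) := by
  have hR : interpRadius s (dist (base z₀) (base z₁)) (radius z₀) (radius z₁) ≠ 0 := by
    rw [← radius_interp]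
    exact_mod_cast h
  rw [interp, base_mk]
  · rw [toBase_of_mem _ (interpPoint_mem hΩ hs _ _ (radius z₀).coe_nonneg
      (radius z₁).coe_nonneg hR)]
  · rwa [interp, radius_mk] at h

/-- The bases move along a segment, so their distance is `|ρ(s) - ρ(t)| L`. The law of cosines then
reduces the claim to the bilinear formula `interp_inner`; at the tip the angular term has
coefficient zero. -/
theorem coneDist_interp (hΩ : Convex ℝ Ω) {s t : ℝ} (hs : s ∈ Set.Icc (0 : ℝ) 1)
    (ht : t ∈ Set.Icc (0 : ℝ) 1) (z₀ z₁ : Cone Ω) :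
    coneDist (interp s z₀ z₁) (interp t z₀ z₁) = |s - t| * coneDist z₀ z₁ := by
  rw [← sq_eq_sq₀ (coneDist_nonneg _ _) (mul_nonneg (abs_nonneg _) (coneDist_nonneg _ _)),
    mul_pow, sq_abs, coneDist_sq, coneDist_sq]
  have hin : (radius (interp s z₀ z₁) : ℝ) * radius (interp t z₀ z₁)
      * cosPi (dist (base (interp s z₀ z₁)) (base (interp t z₀ z₁)))
      = (radius (interp s z₀ z₁) : ℝ) * radius (interp t z₀ z₁)
      * cosPi (|interpRho s (dist (base z₀) (base z₁)) (radius z₀) (radius z₁)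
          - interpRho t (dist (base z₀) (base z₁)) (radius z₀) (radius z₁)|
        * dist (base z₀) (base z₁)) := by
    by_cases h0 : radius (interp s z₀ z₁) = 0
    · simp [h0]
    by_cases h1 : radius (interp t z₀ z₁) = 0
    · simp [h1]
    congr 2
    rw [Subtype.dist_eq, base_interp hΩ hs h0, base_interp hΩ ht h1, interpPoint, interpPoint,
      ← AffineMap.lineMap_apply_module, ← AffineMap.lineMap_apply_module, dist_lineMap_lineMap,
      Real.dist_eq]
    rfl
  rw [mul_assoc (2 * _), mul_assoc 2, ← mul_assoc (radius (interp s z₀ z₁) : ℝ), hin]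
  simp only [radius_interp]
  rw [interp_inner hs ht dist_nonneg (radius z₀).coe_nonneg (radius z₁).coe_nonneg,
    interpRadius_sq hs (radius z₀).coe_nonneg (radius z₁).coe_nonneg,
    interpRadius_sq ht (radius z₀).coe_nonneg (radius z₁).coe_nonneg]
  ring

theorem interp_eq_of_radius_eq (hΩ : Convex ℝ Ω) {s : ℝ} (hs : s ∈ Set.Icc (0 : ℝ) 1)
    {z₀ z₁ z : Cone Ω}
    (hr : interpRadius s (dist (base z₀) (base z₁)) (radius z₀) (radius z₁) = radius z)
    (hX : 0 < (radius z : ℝ) → interpPoint s (base z₀ : EuclideanSpace ℝ (Fin d)) (base z₁)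
      (radius z₀) (radius z₁) = base z) : interp s z₀ z₁ = z := by
  have hr' : radius (interp s z₀ z₁) = radius z := by
    rw [← radius_interp] at hr
    exact_mod_cast hr
  rw [← mk_base_radius (interp s z₀ z₁), hr']
  conv_rhs => rw [← mk_base_radius z]
  rcases eq_or_ne (radius z) 0 with h | h
  · rw [h]; exact mk_zero _ _
  · congr 1
    refine Subtype.ext ?_
    rw [base_interp hΩ hs (by rwa [hr']),
      hX (lt_of_le_of_ne (radius z).coe_nonneg (by exact_mod_cast h.symm))]

theorem interp_zero (hΩ : Convex ℝ Ω) (z₀ z₁ : Cone Ω) : interp 0 z₀ z₁ = z₀ := by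
  have hR : interpRadius 0 (dist (base z₀) (base z₁)) (radius z₀) (radius z₁) = radius z₀ := by
    simp [interpRadius]
  refine interp_eq_of_radius_eq hΩ (by simp) hR fun h => ?_
  have hd : dist (base z₀ : EuclideanSpace ℝ (Fin d)) (base z₁) = dist (base z₀) (base z₁) := rfl
  rw [interpPoint, hd, interpRho, hR]
  split_ifs with hpi
  · simp [h.ne']
  · rw [Real.sign_of_neg (by linarith)]
    norm_num

theorem interp_one (hΩ : Convex ℝ Ω) (z₀ z₁ : Cone Ω) : interp 1 z₀ z₁ = z₁ := by
  have hR : interpRadius 1 (dist (base z₀) (base z₁)) (radius z₀) (radius z₁) = radius z₁ := by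
    simp [interpRadius]
  refine interp_eq_of_radius_eq hΩ (by simp) hR fun h => ?_
  have hd : dist (base z₀ : EuclideanSpace ℝ (Fin d)) (base z₁) = dist (base z₀) (base z₁) := rfl
  rw [interpPoint, hd, interpRho, hR]
  split_ifs with hpi
  · rw [sub_self, zero_mul, zero_add, one_mul, mul_div_cancel_left₀ _ h.ne',
      Real.arccos_cos dist_nonneg hpi.le]
    by_cases hd : base z₀ = base z₁
    · simp [hd]
    · rw [one_div_mul_cancel (dist_ne_zero.2 hd)]
      simp
  · rw [Real.sign_of_pos (by linarith)]
    norm_num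

theorem isConeGeodesic_interp (hΩ : Convex ℝ Ω) (z₀ z₁ : Cone Ω) :
    IsConeGeodesic fun s : I => interp (s : ℝ) z₀ z₁ := by
  intro s t
  rw [coneDist_interp hΩ s.2 t.2]
  simp only [Set.Icc.coe_zero, Set.Icc.coe_one, interp_zero hΩ, interp_one hΩ]

/-! ### Geodesics and their pieces -/

/-- The point `z(t)` of the curve for real parameters `t`. -/
def extendCurve (z : I → Cone Ω) (t : ℝ) : Cone Ω := z (Set.projIcc 0 1 zero_le_one t)

theorem IsConeGeodesic.coneDist_extendCurve {z : I → Cone Ω} (hz : IsConeGeodesic z) {a b : ℝ}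
    (ha : a ∈ Set.Icc (0 : ℝ) 1) (hb : b ∈ Set.Icc (0 : ℝ) 1) :
    coneDist (extendCurve z a) (extendCurve z b) = |a - b| * coneDist (z 0) (z 1) := by
  unfold extendCurve
  rw [Set.projIcc_of_mem _ ha, Set.projIcc_of_mem _ hb, hz]

theorem IsConeGeodesic.isBetween {z : I → Cone Ω} (hz : IsConeGeodesic z) {a b t : ℝ}
    (ha : 0 ≤ a) (hab : a ≤ b) (hb : b ≤ 1) (ht : t ∈ Set.Icc (0 : ℝ) 1) :
    IsBetween t (extendCurve z a) (extendCurve z ((1 - t) * a + t * b)) (extendCurve z b) := by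
  have h1 : a ≤ (1 - t) * a + t * b := by nlinarith [ht.1]
  have h2 : (1 - t) * a + t * b ≤ b := by nlinarith [ht.2]
  have ha' : a ∈ Set.Icc (0 : ℝ) 1 := ⟨ha, hab.trans hb⟩
  have hb' : b ∈ Set.Icc (0 : ℝ) 1 := ⟨ha.trans hab, hb⟩
  have hm : (1 - t) * a + t * b ∈ Set.Icc (0 : ℝ) 1 := ⟨ha.trans h1, h2.trans hb⟩
  unfold IsBetween
  rw [hz.coneDist_extendCurve ha' hm, hz.coneDist_extendCurve hm hb',
    hz.coneDist_extendCurve ha' hb', abs_of_nonpos (by linarith), abs_of_nonpos (by linarith),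
    abs_of_nonpos (by linarith)]
  constructor <;> ring

/-- On a geodesic between two points with bases less than `π` apart, the radius is bounded
below. -/
theorem IsBetween.le_radius_sq {s : ℝ} (hs : s ∈ Set.Icc (0 : ℝ) 1) {z₀ w z₁ : Cone Ω}
    (h : IsBetween s z₀ w z₁) :
    (1 + cosPi (dist (base z₀) (base z₁))) / 2 * min (radius z₀ : ℝ) (radius z₁) ^ 2
      ≤ (radius w : ℝ) ^ 2 := by
  obtain ⟨hsq, -⟩ := h.equations hs rfl rfl
  have hc := neg_one_le_cosPi (dist (base z₀) (base z₁))
  have hc' := cosPi_le_one (dist (base z₀) (base z₁))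
  have hm : 0 ≤ min (radius z₀ : ℝ) (radius z₁) :=
    le_min (radius z₀).coe_nonneg (radius z₁).coe_nonneg
  have hle : min (radius z₀ : ℝ) (radius z₁) ≤ (1 - s) * radius z₀ + s * radius z₁ := by
    nlinarith [mul_le_mul_of_nonneg_left (min_le_left (radius z₀ : ℝ) (radius z₁))
      (sub_nonneg.2 hs.2), mul_le_mul_of_nonneg_left (min_le_right (radius z₀ : ℝ) (radius z₁))
      hs.1]
  generalize min (radius z₀ : ℝ) (radius z₁) = m at *
  generalize (1 - s) * (radius z₀ : ℝ) = u at *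
  generalize s * (radius z₁ : ℝ) = v at *
  generalize cosPi (dist (base z₀) (base z₁)) = c at *
  have h1 : m ^ 2 ≤ (u + v) ^ 2 := by nlinarith
  -- This uses `u² + v² + 2uvc = (1 + c)/2 · (u + v)² + (1 - c)/2 · (u - v)²`.
  nlinarith [mul_le_mul_of_nonneg_left h1 (by linarith : 0 ≤ (1 + c) / 2),
    mul_nonneg (sub_nonneg.2 hc') (sq_nonneg (u - v))]

theorem cosPi_nonneg_of_coneDist_le {z w : Cone Ω} (hz : 0 < (radius z : ℝ))
    (hw : 0 < (radius w : ℝ)) (h : coneDist z w ^ 2 ≤ (radius z : ℝ) ^ 2 + (radius w : ℝ) ^ 2) :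
    0 ≤ cosPi (dist (base z) (base w)) := by
  rw [coneDist_sq] at h
  by_contra hc
  nlinarith [mul_pos (mul_pos hz hw) (neg_pos.2 (not_le.1 hc))]

/-! ### From small angles to all geodesics -/

/-- `Λ`-convexity along the interpolators between two points at an angle of at most `π / 2`. -/
def ConvexAtAcuteAngles (f : Cone Ω → ℝ) (Λ : ℝ) : Prop :=
  ∀ z₀ z₁ : Cone Ω, 0 < (radius z₀ : ℝ) → 0 < (radius z₁ : ℝ) →
    0 ≤ cosPi (dist (base z₀) (base z₁)) → ∀ s ∈ Set.Icc (0 : ℝ) 1,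
      f (interp s z₀ z₁) ≤ (1 - s) * f z₀ + s * f z₁ - Λ * (s * (1 - s) / 2) * coneDist z₀ z₁ ^ 2

/-- Along the ray over `x` the potential is `Φ(x) r²` on a Euclidean half-line, with second
derivative `2 Φ(x)`. The radii `1`, `3/2`, `2` suffice to extract the bound. -/
theorem ConvexAtAcuteAngles.half_le (hΩ : Convex ℝ Ω) {Φ : C(Ω, ℝ)} {Λ : ℝ}
    (h : ConvexAtAcuteAngles (conePotential Φ) Λ) (x : Ω) : Λ / 2 ≤ Φ x := by
  have hb1 : base (mk x 1) = x := base_mk x one_ne_zero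
  have hb2 : base (mk x 2) = x := base_mk x two_ne_zero
  have h1 : cosPi 0 = 1 := by rw [cosPi_of_le le_rfl Real.pi_pos.le, Real.cos_zero]
  have hs : (1 / 2 : ℝ) ∈ Set.Icc (0 : ℝ) 1 := by constructor <;> norm_num
  have hb3 : base (mk x (3 / 2)) = x := base_mk x (by norm_num)
  have hz : interp (1 / 2) (mk x 1) (mk x 2) = mk x (3 / 2) := by
    refine interp_eq_of_radius_eq hΩ hs ?_ fun _ => ?_
    · rw [← sq_eq_sq₀ (interpRadius_nonneg _ _ _ _) (NNReal.coe_nonneg _),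
        interpRadius_sq hs (NNReal.coe_nonneg _) (NNReal.coe_nonneg _), hb1, hb2, dist_self, h1]
      norm_num
    · rw [hb1, hb2, hb3, interpPoint, ← add_smul, sub_add_cancel, one_smul]
  have key := h (mk x 1) (mk x 2) (by norm_num) (by norm_num)
    (by rw [hb1, hb2, dist_self, h1]; norm_num) (1 / 2) hs
  rw [hz, coneDist_sq, hb1, hb2, dist_self, h1] at key
  simp only [conePotential_mk, radius_mk] at key
  norm_num at key
  linarith

/-- Subtracting `Λ/2 · r²`, for which the inequality is an equality by `hsq`, leaves a nonnegative
potential. Moving to a ray of an endpoint with radius at most `(1 - s) r₀` or `s r₁` scales it by at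
most `(1 - s)²` or `s²`. -/
theorem IsBetween.conePotential_le_of_degenerate {Φ : C(Ω, ℝ)} {Λ : ℝ} (hΦ : ∀ x, Λ / 2 ≤ Φ x)
    {s : ℝ} (hs : s ∈ Set.Icc (0 : ℝ) 1) {z₀ w z₁ : Cone Ω} (h : IsBetween s z₀ w z₁)
    (hdeg : (radius z₀ : ℝ) * radius z₁ * (1 + cosPi (dist (base z₀) (base z₁))) = 0) :
    conePotential Φ w ≤ (1 - s) * conePotential Φ z₀ + s * conePotential Φ z₁
      - Λ * (s * (1 - s) / 2) * coneDist z₀ z₁ ^ 2 := by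
  obtain ⟨hsq, -⟩ := h.equations hs rfl rfl
  have h1s := sub_nonneg.2 hs.2
  have p0 : 0 ≤ (radius z₀ : ℝ) ^ 2 * (Φ (base z₀) - Λ / 2) :=
    mul_nonneg (sq_nonneg _) (sub_nonneg.2 (hΦ _))
  have p1 : 0 ≤ (radius z₁ : ℝ) ^ 2 * (Φ (base z₁) - Λ / 2) :=
    mul_nonneg (sq_nonneg _) (sub_nonneg.2 (hΦ _))
  have hr := (radius w).coe_nonneg
  have main : (radius w : ℝ) ^ 2 * (Φ (base w) - Λ / 2) ≤
      (1 - s) * ((radius z₀ : ℝ) ^ 2 * (Φ (base z₀) - Λ / 2))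
        + s * ((radius z₁ : ℝ) ^ 2 * (Φ (base z₁) - Λ / 2)) := by
    have q0 := mul_nonneg h1s p0
    have q1 := mul_nonneg hs.1 p1
    rcases h.of_degenerate hs hdeg with h | ⟨hb, h⟩ | ⟨hb, h⟩
    · rw [h]
      simpa using add_nonneg q0 q1
    · rw [hb]
      have := mul_le_mul_of_nonneg_right (pow_le_pow_left₀ hr h 2)
        (sub_nonneg.2 (hΦ (base z₀)))
      nlinarith [mul_nonneg hs.1 q0]
    · rw [hb]
      have := mul_le_mul_of_nonneg_right (pow_le_pow_left₀ hr h 2)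
        (sub_nonneg.2 (hΦ (base z₁)))
      nlinarith [mul_nonneg h1s q1]
  unfold conePotential
  rw [coneDist_sq]
  linear_combination main + Λ / 2 * hsq

/-- A local-to-global argument: the squared radius is at least `m > 0` along `z`, and a chord with
squared length at most `m` spans an acute angle by the law of cosines. -/
theorem ConvexAtAcuteAngles.conePotential_le {f : Cone Ω → ℝ} {Λ : ℝ}
    (h : ConvexAtAcuteAngles f Λ) {z : I → Cone Ω} (hz : IsConeGeodesic z)
    (h₀ : 0 < (radius (z 0) : ℝ)) (h₁ : 0 < (radius (z 1) : ℝ))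
    (hpi : -1 < cosPi (dist (base (z 0)) (base (z 1)))) (s : I) :
    f (z s) ≤ (1 - s) * f (z 0) + s * f (z 1)
      - Λ * (s * (1 - s) / 2) * coneDist (z 0) (z 1) ^ 2 := by
  have e0 : extendCurve z 0 = z 0 := by simp [extendCurve]
  have e1 : extendCurve z 1 = z 1 := by simp [extendCurve]
  have es : extendCurve z s = z s := by simp [extendCurve]
  set D := coneDist (z 0) (z 1) with hD
  have hD0 : 0 ≤ D := coneDist_nonneg _ _
  set m := (1 + cosPi (dist (base (z 0)) (base (z 1)))) / 2
    * min (radius (z 0) : ℝ) (radius (z 1)) ^ 2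
  have hm : 0 < m := mul_pos (by linarith) (pow_pos (lt_min h₀ h₁) 2)
  have hrad : ∀ t ∈ Set.Icc (0 : ℝ) 1, m ≤ (radius (extendCurve z t) : ℝ) ^ 2 := by
    intro t ht
    have hb := hz.isBetween le_rfl zero_le_one le_rfl ht
    rw [mul_zero, mul_one, zero_add, e0, e1] at hb
    exact hb.le_radius_sq ht
  have hpos : ∀ t ∈ Set.Icc (0 : ℝ) 1, 0 < (radius (extendCurve z t) : ℝ) := by
    intro t ht
    refine lt_of_le_of_ne (radius _).coe_nonneg fun h => ?_
    have := hrad t ht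
    rw [← h] at this
    norm_num at this
    linarith
  -- Parameter length `δ` keeps chords below `√m`; the summand `1` covers `D = 0`.
  set δ := √m / (D + 1)
  have hδ : 0 < δ := div_pos (Real.sqrt_pos.2 hm) (by linarith)
  have hδD : (δ * D) ^ 2 ≤ m := by
    have : δ * D ≤ √m := by
      rw [div_mul_eq_mul_div, div_le_iff₀ (by linarith)]
      nlinarith [Real.sqrt_nonneg m]
    calc (δ * D) ^ 2 ≤ √m ^ 2 := pow_le_pow_left₀ (mul_nonneg hδ.le hD0) this 2
      _ = m := Real.sq_sqrt hm.le
  have short : ∀ a b, 0 ≤ a → a ≤ b → b ≤ 1 → b ≤ a + δ → ∀ t ∈ Set.Icc (0 : ℝ) 1,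
      f (extendCurve z ((1 - t) * a + t * b)) ≤
        (1 - t) * f (extendCurve z a) + t * f (extendCurve z b)
          - Λ * (t * (1 - t) / 2) * ((b - a) * D) ^ 2 := by
    intro a b ha hab hb hba t ht
    have ha' : a ∈ Set.Icc (0 : ℝ) 1 := ⟨ha, hab.trans hb⟩
    have hb' : b ∈ Set.Icc (0 : ℝ) 1 := ⟨ha.trans hab, hb⟩
    have hdist : coneDist (extendCurve z a) (extendCurve z b) = (b - a) * D := by
      rw [hz.coneDist_extendCurve ha' hb', abs_of_nonpos (by linarith), neg_sub]
    rcases ht.1.eq_or_lt with rfl | ht0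
    · simp
    rcases ht.2.eq_or_lt with rfl | ht1
    · simp
    have hcos : 0 ≤ cosPi (dist (base (extendCurve z a)) (base (extendCurve z b))) := by
      refine cosPi_nonneg_of_coneDist_le (hpos a ha') (hpos b hb') ?_
      rw [hdist]
      have : ((b - a) * D) ^ 2 ≤ (δ * D) ^ 2 :=
        pow_le_pow_left₀ (mul_nonneg (by linarith) hD0)
          (mul_le_mul_of_nonneg_right (by linarith) hD0) 2
      nlinarith [hrad a ha', hrad b hb']
    rw [(hz.isBetween ha hab hb ht).eq_interp ⟨ht0, ht1⟩ (hpos a ha') (hpos b hb')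
      (lt_pi_of_neg_one_lt_cosPi (by linarith)), ← hdist]
    exact h _ _ (hpos a ha') (hpos b hb') hcos t ht
  -- At constant speed `D`, `Λ`-convexity along `z` is ordinary convexity after subtracting `Λ/2 ·
  -- D² t²`.
  have hconv : ConvexOn ℝ (Set.Icc 0 1)
      fun t => f (extendCurve z t) - Λ / 2 * D ^ 2 * t ^ 2 := by
    refine convexOn_Icc_of_short hδ (fun x y hx hxy hy hyx => ?_) zero_le_one
    refine LinearOrder.convexOn_of_lt (convex_Icc x y) ?_
    rintro a ⟨ha, ha'⟩ b ⟨hb, hb'⟩ hab p q hp hq hpq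
    obtain rfl : p = 1 - q := by linarith
    have := short a b (hx.trans ha) hab.le (hb'.trans hy) (by linarith) q
      ⟨hq.le, by linarith⟩
    simp only [smul_eq_mul]
    linear_combination this
  have := hconv.2 (x := 0) (y := 1) (by simp) (by simp) (sub_nonneg.2 s.2.2) s.2.1 (by ring)
  simp only [smul_eq_mul, mul_zero, zero_add, mul_one, e0, e1, es] at this
  linear_combination this

theorem ConvexAtAcuteAngles.geodesicallyConvexOnCone (hΩ : Convex ℝ Ω) {Φ : C(Ω, ℝ)} {Λ : ℝ}
    (h : ConvexAtAcuteAngles (conePotential Φ) Λ) :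
    GeodesicallyConvexOnCone (conePotential Φ) Λ := by
  intro z hz s
  by_cases hdeg : (radius (z 0) : ℝ) * radius (z 1)
      * (1 + cosPi (dist (base (z 0)) (base (z 1)))) = 0
  · have hb := hz.isBetween le_rfl zero_le_one le_rfl s.2
    simp only [mul_zero, mul_one, zero_add, extendCurve, Set.projIcc_left, Set.projIcc_right,
      Set.projIcc_val] at hb
    exact hb.conePotential_le_of_degenerate (h.half_le hΩ) s.2 hdeg
  · simp only [mul_eq_zero, not_or] at hdeg
    obtain ⟨⟨h0, h1⟩, h2⟩ := hdeg
    exact h.conePotential_le hz (lt_of_le_of_ne (radius _).coe_nonneg (Ne.symm h0))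
      (lt_of_le_of_ne (radius _).coe_nonneg (Ne.symm h1))
      (by
        have := lt_of_le_of_ne (neg_le_iff_add_nonneg'.1 (neg_one_le_cosPi _)) (Ne.symm h2)
        linarith) s

/-! ### Measurability and integrability -/

theorem measurable_coneDist : Measurable fun p : Cone Ω × Cone Ω => coneDist p.1 p.2 := by
  have hb₀ : Measurable fun p : Cone Ω × Cone Ω => base p.1 := measurable_base.comp measurable_fst
  have hb₁ : Measurable fun p : Cone Ω × Cone Ω => base p.2 := measurable_base.comp measurable_snd
  have hr₀ : Measurable fun p : Cone Ω × Cone Ω => (radius p.1 : ℝ) :=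
    (measurable_radius.comp measurable_fst).coe_nnreal_real
  have hr₁ : Measurable fun p : Cone Ω × Cone Ω => (radius p.2 : ℝ) :=
    (measurable_radius.comp measurable_snd).coe_nnreal_real
  have hcp : Measurable cosPi :=
    (Real.continuous_cos.comp (continuous_abs.min continuous_const)).measurable
  have hL : Measurable fun p : Cone Ω × Cone Ω => cosPi (dist (base p.1) (base p.2)) :=
    hcp.comp (hb₀.dist hb₁)
  unfold coneDist
  fun_prop

theorem measurable_conePotential (Φ : C(Ω, ℝ)) : Measurable (conePotential Φ) :=
  (measurable_radius.coe_nnreal_real.pow_const 2).mul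
    (Φ.continuous.measurable.comp measurable_base)

theorem potentialEnergy_proj (Φ : C(Ω, ℝ)) (l : Measure (Cone Ω)) :
    potentialEnergy Φ (proj l) = ∫ z, conePotential Φ z ∂l := integral_proj l Φ

theorem MemM2.integrable_radius_sq {l : Measure (Cone Ω)} (h : MemM2 l) :
    Integrable (fun z => (radius z : ℝ) ^ 2) l := by
  refine ⟨(measurable_radius.coe_nnreal_real.pow_const 2).aestronglyMeasurable, ?_⟩
  refine lt_of_le_of_lt (lintegral_mono fun z => ?_) h.2
  rw [enorm_pow, ← NNReal.enorm_eq]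

theorem proj_apply (l : Measure (Cone Ω)) {A : Set Ω} (hA : MeasurableSet A) :
    proj l A = ∫⁻ z in base ⁻¹' A, (radius z : ℝ≥0∞) ^ 2 ∂l := by
  rw [proj, Measure.map_apply measurable_base hA, withDensity_apply _ (measurable_base hA)]
  simp

theorem integral_radius_sq (l : Measure (Cone Ω)) :
    ∫ z, (radius z : ℝ) ^ 2 ∂l = (proj l Set.univ).toReal := by
  rw [proj_apply l MeasurableSet.univ, Set.preimage_univ, Measure.restrict_univ,
    integral_eq_lintegral_of_nonneg_ae (ae_of_all _ fun z => sq_nonneg _)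
      (measurable_radius.coe_nnreal_real.pow_const 2).aestronglyMeasurable]
  congr 2 with z
  rw [ENNReal.ofReal_pow (NNReal.coe_nonneg _), ENNReal.ofReal_coe_nnreal]

theorem memM2_dirac (z : Cone Ω) : MemM2 (Measure.dirac z) := by
  refine ⟨inferInstance, ?_⟩
  rw [lintegral_dirac' _ (measurable_radius.coe_nnreal_ennreal.pow_const 2)]
  exact ENNReal.pow_lt_top ENNReal.coe_lt_top

/-- A lift of the projection of a Dirac mass is concentrated on a ray. -/
theorem ae_of_proj_eq_proj_dirac {l : Measure (Cone Ω)} {z : Cone Ω}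
    (h : proj l = proj (Measure.dirac z)) : ∀ᵐ w ∂l, radius w = 0 ∨ base w = base z := by
  have hA : MeasurableSet ({base z}ᶜ : Set Ω) := (measurableSet_singleton _).compl
  have h0 : proj l {base z}ᶜ = 0 := by
    classical
    rw [h, proj_apply _ hA, restrict_dirac' (measurable_base hA)]
    simp
  rw [proj_apply _ hA, lintegral_eq_zero_iff (measurable_radius.coe_nnreal_ennreal.pow_const 2),
    Filter.EventuallyEq, ae_restrict_iff' (measurable_base hA)] at h0
  filter_upwards [h0] with w hw
  by_cases hb : base w = base z
  · exact Or.inr hb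
  · left
    simpa using hw hb

theorem integral_radius_sq_of_proj_eq {l : Measure (Cone Ω)} {z : Cone Ω}
    (h : proj l = proj (Measure.dirac z)) : ∫ w, (radius w : ℝ) ^ 2 ∂l = (radius z : ℝ) ^ 2 := by
  rw [integral_radius_sq, h, ← integral_radius_sq, integral_dirac']
  exact (measurable_radius.coe_nnreal_real.pow_const 2).stronglyMeasurable

/-- Needed because the minorant of the cost used below may take negative values, which
`ENNReal.ofReal` truncates. -/
theorem ofReal_integral_le_lintegral_ofReal {α : Type*} [MeasurableSpace α] {μ : Measure α}
    {f : α → ℝ} (hf : Integrable f μ) :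
    ENNReal.ofReal (∫ x, f x ∂μ) ≤ ∫⁻ x, ENNReal.ofReal (f x) ∂μ := by
  rw [integral_eq_lintegral_pos_part_sub_lintegral_neg_part hf]
  exact (ENNReal.ofReal_le_ofReal (sub_le_self _ ENNReal.toReal_nonneg)).trans
    ENNReal.ofReal_toReal_le

/-! ### Optimality of Dirac plans -/

/-- A duality bound. Both lifts live on single rays and have prescribed second moments, so a
minorant of the cost of the form `a ρ₀² + b ρ₁²` has the same integral for all plans. Weighted AM-GM
gives one, with equality at `ρ₀ = r₀`, `ρ₁ = r₁`; its use requires `c ≥ 0`. -/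
theorem coneDist_sq_le_planCost {z₀ z₁ : Cone Ω} (h₀ : 0 < (radius z₀ : ℝ))
    (h₁ : 0 < (radius z₁ : ℝ)) (hc : 0 ≤ cosPi (dist (base z₀) (base z₁)))
    {l₀ l₁ : Measure (Cone Ω)} (hl₀ : IsLift l₀ (proj (Measure.dirac z₀)))
    (hl₁ : IsLift l₁ (proj (Measure.dirac z₁))) {γ : Measure (Cone Ω × Cone Ω)}
    (hγ : IsPlan l₀ l₁ γ) : ENNReal.ofReal (coneDist z₀ z₁ ^ 2) ≤ planCost γ := by
  have hrm : Measurable fun z : Cone Ω => (radius z : ℝ) ^ 2 :=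
    measurable_radius.coe_nnreal_real.pow_const 2
  set c := cosPi (dist (base z₀) (base z₁)) with hcdef
  set r₀ := (radius z₀ : ℝ)
  set r₁ := (radius z₁ : ℝ)
  have i0 : Integrable (fun p : Cone Ω × Cone Ω => (radius p.1 : ℝ) ^ 2) γ := by
    have := hl₀.1.integrable_radius_sq
    rw [← hγ.1] at this
    exact this.comp_measurable measurable_fst
  have i1 : Integrable (fun p : Cone Ω × Cone Ω => (radius p.2 : ℝ) ^ 2) γ := by
    have := hl₁.1.integrable_radius_sq
    rw [← hγ.2] at this
    exact this.comp_measurable measurable_snd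
  have v0 : ∫ p, (radius p.1 : ℝ) ^ 2 ∂γ = r₀ ^ 2 := by
    rw [← integral_radius_sq_of_proj_eq hl₀.2, ← hγ.1,
      integral_map measurable_fst.aemeasurable hrm.aestronglyMeasurable]
  have v1 : ∫ p, (radius p.2 : ℝ) ^ 2 ∂γ = r₁ ^ 2 := by
    rw [← integral_radius_sq_of_proj_eq hl₁.2, ← hγ.2,
      integral_map measurable_snd.aemeasurable hrm.aestronglyMeasurable]
  have a0 : ∀ᵐ p ∂γ, radius p.1 = 0 ∨ base p.1 = base z₀ := by
    have := ae_of_proj_eq_proj_dirac hl₀.2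
    rw [← hγ.1] at this
    exact ae_of_ae_map measurable_fst.aemeasurable this
  have a1 : ∀ᵐ p ∂γ, radius p.2 = 0 ∨ base p.2 = base z₁ := by
    have := ae_of_proj_eq_proj_dirac hl₁.2
    rw [← hγ.2] at this
    exact ae_of_ae_map measurable_snd.aemeasurable this
  have hint : ∫ p, ((1 - c * (r₁ / r₀)) * (radius p.1 : ℝ) ^ 2
      + (1 - c * (r₀ / r₁)) * (radius p.2 : ℝ) ^ 2) ∂γ = coneDist z₀ z₁ ^ 2 := by
    rw [integral_add (i0.const_mul _) (i1.const_mul _), integral_const_mul, integral_const_mul,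
      v0, v1, coneDist_sq]
    field_simp
    ring
  rw [← hint]
  refine (ofReal_integral_le_lintegral_ofReal ((i0.const_mul _).add (i1.const_mul _))).trans ?_
  refine lintegral_mono_ae ?_
  filter_upwards [a0, a1] with p hp0 hp1
  refine ENNReal.ofReal_le_ofReal ?_
  rw [Pi.add_apply]
  -- Mass at the tip has an arbitrary base, but there the product of the radii is zero.
  have hcos : (radius p.1 : ℝ) * radius p.2 * cosPi (dist (base p.1) (base p.2))
      = radius p.1 * radius p.2 * c := by
    rcases hp0 with h | h
    · simp [h]
    rcases hp1 with h' | h'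
    · simp [h']
    rw [h, h']
  have amgm : 2 * ((radius p.1 : ℝ) * radius p.2)
      ≤ r₁ / r₀ * (radius p.1 : ℝ) ^ 2 + r₀ / r₁ * (radius p.2 : ℝ) ^ 2 := by
    have : r₁ / r₀ * (radius p.1 : ℝ) ^ 2 + r₀ / r₁ * (radius p.2 : ℝ) ^ 2
        - 2 * ((radius p.1 : ℝ) * radius p.2)
        = (r₁ * radius p.1 - r₀ * radius p.2) ^ 2 / (r₀ * r₁) := by
      field_simp
      ring
    have h2 : 0 ≤ (r₁ * radius p.1 - r₀ * radius p.2) ^ 2 / (r₀ * r₁) := by positivity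
    linarith
  rw [coneDist_sq]
  linear_combination 2 * hcos + c * amgm

theorem planCost_dirac (z₀ z₁ : Cone Ω) :
    planCost (Measure.dirac (z₀, z₁)) = ENNReal.ofReal (coneDist z₀ z₁ ^ 2) :=
  lintegral_dirac' _ (measurable_coneDist.pow_const 2).ennreal_ofReal

theorem isPlan_dirac (z₀ z₁ : Cone Ω) :
    IsPlan (Measure.dirac z₀) (Measure.dirac z₁) (Measure.dirac (z₀, z₁)) :=
  ⟨Measure.map_dirac' measurable_fst _, Measure.map_dirac' measurable_snd _⟩

theorem isOptimal_dirac {z₀ z₁ : Cone Ω} (h₀ : 0 < (radius z₀ : ℝ)) (h₁ : 0 < (radius z₁ : ℝ))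
    (hc : 0 ≤ cosPi (dist (base z₀) (base z₁))) :
    IsOptimal (proj (Measure.dirac z₀)) (proj (Measure.dirac z₁)) (Measure.dirac z₀)
        (Measure.dirac z₁) (Measure.dirac (z₀, z₁)) ∧
      HK (proj (Measure.dirac z₀)) (proj (Measure.dirac z₁))
        = ENNReal.ofReal (coneDist z₀ z₁) := by
  have hroot : (ENNReal.ofReal (coneDist z₀ z₁ ^ 2)) ^ (1 / 2 : ℝ)
      = ENNReal.ofReal (coneDist z₀ z₁) := by
    rw [ENNReal.ofReal_pow (coneDist_nonneg _ _), ← ENNReal.rpow_natCast, ← ENNReal.rpow_mul]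
    norm_num
  have lower : ENNReal.ofReal (coneDist z₀ z₁)
      ≤ HK (proj (Measure.dirac z₀)) (proj (Measure.dirac z₁)) := by
    unfold HK
    refine le_iInf fun l₀ => le_iInf fun l₁ => le_iInf fun hl₀ => le_iInf fun hl₁ => ?_
    rw [← hroot, wassersteinCone]
    refine ENNReal.rpow_le_rpow ?_ (by norm_num)
    exact le_iInf fun γ => le_iInf fun hγ => coneDist_sq_le_planCost h₀ h₁ hc hl₀ hl₁ hγ
  have l0 : IsLift (Measure.dirac z₀) (proj (Measure.dirac z₀)) := ⟨memM2_dirac z₀, rfl⟩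
  have l1 : IsLift (Measure.dirac z₁) (proj (Measure.dirac z₁)) := ⟨memM2_dirac z₁, rfl⟩
  have hle : HK (proj (Measure.dirac z₀)) (proj (Measure.dirac z₁))
      ≤ wassersteinCone (Measure.dirac z₀) (Measure.dirac z₁) :=
    iInf_le_of_le _ (iInf_le_of_le _ (iInf_le_of_le l0 (iInf_le_of_le l1 le_rfl)))
  have upper : wassersteinCone (Measure.dirac z₀) (Measure.dirac z₁)
      ≤ ENNReal.ofReal (coneDist z₀ z₁) := by
    rw [← hroot, wassersteinCone]
    refine ENNReal.rpow_le_rpow ?_ (by norm_num)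
    rw [← planCost_dirac]
    exact iInf_le_of_le _ (iInf_le_of_le (isPlan_dirac z₀ z₁) le_rfl)
  have hHK := le_antisymm (hle.trans upper) lower
  have hW := le_antisymm upper (lower.trans hle)
  refine ⟨⟨⟨l0, l1, hW.trans hHK.symm⟩, isPlan_dirac z₀ z₁, ?_⟩, hHK⟩
  rw [planCost_dirac, hW, ENNReal.ofReal_pow (coneDist_nonneg _ _)]

theorem isFiniteMeasure_proj_dirac (z : Cone Ω) : IsFiniteMeasure (proj (Measure.dirac z)) := by
  refine ⟨?_⟩
  rw [proj_apply _ .univ, Set.preimage_univ, Measure.restrict_univ]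
  exact (memM2_dirac z).2

/-- For the optimal Dirac plan, the lifted curve is the Dirac mass at `interp s z₀ z₁`, so all
integrals become point values. -/
theorem convexAtAcuteAngles_of_convexAlongConePlanGeodesics (hcl : IsClosed Ω) {Φ : C(Ω, ℝ)}
    {Λ : ℝ} (h : ConvexAlongConePlanGeodesics (potentialEnergy Φ) Λ) :
    ConvexAtAcuteAngles (conePotential Φ) Λ := by
  intro z₀ z₁ h₀ h₁ hc s hs
  obtain ⟨hopt, hHK⟩ := isOptimal_dirac h₀ h₁ hc
  have key := h _ _ (isFiniteMeasure_proj_dirac z₀) (isFiniteMeasure_proj_dirac z₁) _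
    ⟨_, _, _, hopt, fun _ => rfl⟩ ⟨s, hs⟩
  have hd : ∀ z : Cone Ω, ∫ w, conePotential Φ w ∂(Measure.dirac z) = conePotential Φ z :=
    fun z => integral_dirac' _ _ (measurable_conePotential Φ).stronglyMeasurable
  simp only [potentialEnergy_proj, Measure.map_dirac' (measurable_interp hcl s), hd, hHK,
    ENNReal.toReal_ofReal (coneDist_nonneg _ _)] at key
  exact key

/-! ### Integration along a plan -/

theorem abs_conePotential_le [CompactSpace Ω] (Φ : C(Ω, ℝ)) (z : Cone Ω) :
    |conePotential Φ z| ≤ ‖Φ‖ * (radius z : ℝ) ^ 2 := by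
  rw [conePotential, abs_mul, abs_of_nonneg (sq_nonneg _), mul_comm]
  exact mul_le_mul_of_nonneg_right (Φ.norm_coe_le_norm _) (sq_nonneg _)

theorem coneDist_sq_le (z w : Cone Ω) :
    coneDist z w ^ 2 ≤ 2 * (radius z : ℝ) ^ 2 + 2 * (radius w : ℝ) ^ 2 := by
  rw [coneDist_sq]
  nlinarith [mul_nonneg (mul_nonneg (radius z).coe_nonneg (radius w).coe_nonneg)
    (neg_le_iff_add_nonneg.1 (neg_one_le_cosPi (dist (base z) (base w)))),
    sq_nonneg ((radius z : ℝ) - radius w)]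

theorem radius_interp_sq_le {s : ℝ} (hs : s ∈ Set.Icc (0 : ℝ) 1) (z₀ z₁ : Cone Ω) :
    (radius (interp s z₀ z₁) : ℝ) ^ 2 ≤ (radius z₀ : ℝ) ^ 2 + (radius z₁ : ℝ) ^ 2 := by
  have hd : 0 ≤ coneDist z₀ z₁ ^ 2 := sq_nonneg _
  rw [coneDist_sq] at hd
  rw [radius_interp, interpRadius_sq hs (radius z₀).coe_nonneg (radius z₁).coe_nonneg]
  have h := mul_nonneg (mul_nonneg hs.1 (sub_nonneg.2 hs.2)) hd
  nlinarith [mul_nonneg hs.1 (sq_nonneg (radius z₀ : ℝ)),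
    mul_nonneg (sub_nonneg.2 hs.2) (sq_nonneg (radius z₁ : ℝ))]

theorem GeodesicallyConvexOnCone.convexAlongConePlanGeodesics (hΩ : Convex ℝ Ω)
    (hcomp : IsCompact Ω) {Φ : C(Ω, ℝ)} {Λ : ℝ}
    (h : GeodesicallyConvexOnCone (conePotential Φ) Λ) :
    ConvexAlongConePlanGeodesics (potentialEnergy Φ) Λ := by
  have : CompactSpace Ω := isCompact_iff_compactSpace.1 hcomp
  rintro μ₀ μ₁ - - μ ⟨l₀, l₁, γ, ⟨⟨hl₀, hl₁, hW⟩, hγ, hcost⟩, hμ⟩ s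
  have hm := measurable_conePotential Φ
  have i0 : Integrable (fun p : Cone Ω × Cone Ω => (radius p.1 : ℝ) ^ 2) γ := by
    have := hl₀.1.integrable_radius_sq
    rw [← hγ.1] at this
    exact this.comp_measurable measurable_fst
  have i1 : Integrable (fun p : Cone Ω × Cone Ω => (radius p.2 : ℝ) ^ 2) γ := by
    have := hl₁.1.integrable_radius_sq
    rw [← hγ.2] at this
    exact this.comp_measurable measurable_snd
  have hint := measurable_interp hcomp.isClosed (s : ℝ)
  have f0 : potentialEnergy Φ μ₀ = ∫ p, conePotential Φ p.1 ∂γ := by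
    rw [← hl₀.2, potentialEnergy_proj, ← hγ.1,
      integral_map measurable_fst.aemeasurable hm.aestronglyMeasurable]
  have f1 : potentialEnergy Φ μ₁ = ∫ p, conePotential Φ p.2 ∂γ := by
    rw [← hl₁.2, potentialEnergy_proj, ← hγ.2,
      integral_map measurable_snd.aemeasurable hm.aestronglyMeasurable]
  have fs : potentialEnergy Φ (μ s) = ∫ p, conePotential Φ (interp (s : ℝ) p.1 p.2) ∂γ := by
    rw [hμ, potentialEnergy_proj, integral_map hint.aemeasurable hm.aestronglyMeasurable]
  -- Optimality of the lifts and of the plan enters only here.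
  have fd : (HK μ₀ μ₁).toReal ^ 2 = ∫ p, coneDist p.1 p.2 ^ 2 ∂γ := by
    rw [← hW, ← ENNReal.toReal_pow, ← hcost, planCost,
      integral_eq_lintegral_of_nonneg_ae (ae_of_all _ fun p => sq_nonneg _)
        (measurable_coneDist.pow_const 2).aestronglyMeasurable]
  have j0 : Integrable (fun p : Cone Ω × Cone Ω => conePotential Φ p.1) γ :=
    (i0.const_mul ‖Φ‖).mono' (hm.comp measurable_fst).aestronglyMeasurable
      (ae_of_all _ fun p => abs_conePotential_le Φ p.1)
  have j1 : Integrable (fun p : Cone Ω × Cone Ω => conePotential Φ p.2) γ :=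
    (i1.const_mul ‖Φ‖).mono' (hm.comp measurable_snd).aestronglyMeasurable
      (ae_of_all _ fun p => abs_conePotential_le Φ p.2)
  have js : Integrable (fun p : Cone Ω × Cone Ω => conePotential Φ (interp (s : ℝ) p.1 p.2)) γ :=
    ((i0.add i1).const_mul ‖Φ‖).mono' (hm.comp hint).aestronglyMeasurable
      (ae_of_all _ fun p => (abs_conePotential_le Φ _).trans
        (mul_le_mul_of_nonneg_left (radius_interp_sq_le s.2 _ _) (norm_nonneg _)))
  have jd : Integrable (fun p : Cone Ω × Cone Ω => coneDist p.1 p.2 ^ 2) γ :=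
    ((i0.const_mul 2).add (i1.const_mul 2)).mono'
      (measurable_coneDist.pow_const 2).aestronglyMeasurable
      (ae_of_all _ fun p => by
        rw [Real.norm_of_nonneg (sq_nonneg _)]
        exact coneDist_sq_le p.1 p.2)
  have hsum : Integrable (fun p : Cone Ω × Cone Ω => (1 - (s : ℝ)) * conePotential Φ p.1
      + (s : ℝ) * conePotential Φ p.2) γ := (j0.const_mul (1 - (s : ℝ))).add (j1.const_mul (s : ℝ))
  rw [f0, f1, fs, fd, ← integral_const_mul, ← integral_const_mul, ← integral_const_mul,
    ← integral_add (j0.const_mul _) (j1.const_mul _), ← integral_sub hsum (jd.const_mul _)]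
  refine integral_mono js (hsum.sub (jd.const_mul _)) fun p => ?_
  have := h _ (isConeGeodesic_interp hΩ p.1 p.2) s
  simp only [Set.Icc.coe_zero, Set.Icc.coe_one, interp_zero hΩ, interp_one hΩ] at this
  exact this

end HKCone

end

theorem mainTheorem10 {d : ℕ} (Ω : Set (EuclideanSpace ℝ (Fin d))) (hconv : Convex ℝ Ω)
    (hcomp : IsCompact Ω) (Φ : C(Ω, ℝ)) (Λ : ℝ) :
    HKCone.ConvexAlongConePlanGeodesics (HKCone.potentialEnergy Φ) Λ ↔
      HKCone.GeodesicallyConvexOnCone (HKCone.conePotential Φ) Λ :=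
  ⟨fun h => (HKCone.convexAtAcuteAngles_of_convexAlongConePlanGeodesics hcomp.isClosed
      h).geodesicallyConvexOnCone hconv,
    fun h => h.convexAlongConePlanGeodesics hconv hcomp⟩
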